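/- Let $F$ be a number field of odd degree over $\mathbb{Q}$, let $K$ be an imaginary quadratic field with discriminant $d_K$, and let $E$ be an elliptic curve over $F$ with complex multiplication by an order in $K$, i.e. the ring $\mathrm{End}_{\overline{F}}(E)$ of endomorphisms of $E$ defined over an algebraic closure $\overline{F}$ of $F$ is isomorphic to an order in $K$. Let $\ell$ be an odd prime number, let $F(E[\ell])\subseteq\overline F$ be the field generated over $F$ by the coordinates of the $\ell$-torsion points of $E(\overline{F})$, and let $F(\mu_\ell)\subseteq\overline F$ be the field generated over $F$ by the $\ell$-th roots of unity (recall $F(\mu_\ell)\subseteq F(E[\ell])$). If the degree $[F(E[\ell]):F(\mu_\ell)]$ is a power $\ell^k$ of $\ell$ with $k\ge 0$, then $\ell$ divides $d_K$. -/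

import Mathlib

noncomputable section

namespace EllipticCM

open scoped Classical

universe u v

/-- Homogeneous coordinates `[X : Y : Z]` in `ℙ²` of a point of a Weierstrass curve: the point at
infinity is `[0 : 1 : 0]`, and an affine point `(x, y)` is `[x : y : 1]`. -/
def projCoords {L : Type u} [Field L] {W : WeierstrassCurve L} : W.toAffine.Point → (Fin 3 → L)
  | .zero => ![0, 1, 0]
  | .some x y _ => ![x, y, 1]

/-- For an elliptic curve `W` over an algebraically closed field `L`: the map `φ : W(L) → W(L)` is
(the map on points of) a morphism of projective varieties. That is, around every point `P` it is
given by a triple of homogeneous polynomials of one common degree, not all vanishing at `P`, which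
compute `φ` wherever they do not all vanish. -/
def IsMorphism {L : Type u} [Field L] (W : WeierstrassCurve L)
    (φ : W.toAffine.Point → W.toAffine.Point) : Prop :=
  ∀ P : W.toAffine.Point, ∃ (d : ℕ) (A : Fin 3 → MvPolynomial (Fin 3) L),
    (∀ i, (A i).IsHomogeneous d) ∧
    (∃ i, MvPolynomial.eval (projCoords P) (A i) ≠ 0) ∧
    ∀ Q : W.toAffine.Point, (∃ i, MvPolynomial.eval (projCoords Q) (A i) ≠ 0) →
      ∃ c : L, ∀ i, MvPolynomial.eval (projCoords Q) (A i) = c * projCoords (φ Q) i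

/-- The group `E(F̄)` of points of `E` over the algebraic closure of `F`. -/
abbrev GeomPoint {F : Type u} [Field F] (E : WeierstrassCurve F) : Type u :=
  (E.baseChange (AlgebraicClosure F)).toAffine.Point

/-- A subring `O` of a number field `K` is an order: it is finitely generated as a `ℤ`-module and
spans `K` over `ℚ`. -/
def IsOrder {K : Type v} [Field K] [NumberField K] (O : Subring K) : Prop :=
  Module.Finite ℤ O ∧ Submodule.span ℚ (O : Set K) = ⊤

/-- The ring `End_{F̄}(E)` of geometric endomorphisms of `E` is isomorphic to `O`. Here
`End_{F̄}(E)` is the set of those group endomorphisms of `E(F̄)` that are morphisms of varieties,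
with pointwise addition and with composition as multiplication; the isomorphism is expressed as an
injective ring homomorphism from `O` to the ring of all group endomorphisms of `E(F̄)` whose range
is exactly that set. -/
def HasGeomEndRing {F : Type u} [Field F] (E : WeierstrassCurve F) (O : Type v) [Ring O] : Prop :=
  ∃ ι : O →+* AddMonoid.End (GeomPoint E), Function.Injective ι ∧
    ∀ φ : AddMonoid.End (GeomPoint E),
      (∃ a, ι a = φ) ↔ IsMorphism (E.baseChange (AlgebraicClosure F)) φ

/-- `E` has complex multiplication by an order in `K` (for `K` an imaginary quadratic field). -/
def HasCMByOrderIn {F : Type u} [Field F] (E : WeierstrassCurve F)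
    (K : Type v) [Field K] [NumberField K] : Prop :=
  ∃ O : Subring K, IsOrder O ∧ HasGeomEndRing E O

/-- The field `F(E[n]) ⊆ F̄` generated over `F` by the affine coordinates of all points
of `E(F̄)` killed by `n`. -/
def torsionField {F : Type u} [Field F] (E : WeierstrassCurve F) (n : ℕ) :
    IntermediateField F (AlgebraicClosure F) :=
  IntermediateField.adjoin F
    {z | ∃ (x y : AlgebraicClosure F)
      (h : (E.baseChange (AlgebraicClosure F)).toAffine.Nonsingular x y),
      n • (WeierstrassCurve.Affine.Point.some x y h : GeomPoint E) = 0 ∧ (z = x ∨ z = y)}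

/-- The field `F(μ_n) ⊆ F̄` generated over `F` by all `n`-th roots of unity. -/
def rootsOfUnityField (F : Type u) [Field F] (n : ℕ) :
    IntermediateField F (AlgebraicClosure F) :=
  IntermediateField.adjoin F {z | z ^ n = 1}

end EllipticCM

end

/-!
The order in `K` contains a square root `ψ` of a negative integer `-D`. The heart of the matter is
that `F(E[ℓ])` contains a square root `r` of `± D`, and of `-D` in case `D` is a square
(`exists_sqrt_mem_torsionField`). Here `r` is the derivative of `ψ` at infinity, that is, the number
by which `ψ` acts on the tangent space of `E`. Since the derivative is multiplicative, `r ^ 2` is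
minus the derivative of multiplication by `D`, whose square is `D ^ 2`. Let `σ` be an automorphism
of the algebraic closure fixing `F(E[ℓ])`. The conjugate of `ψ` by `σ` is again an endomorphism with
square `-D`, so it is `ψ` or `-ψ`. It cannot be `-ψ`: as `σ` fixes `E[ℓ]`, a power of `σ` with odd
exponent `ℓ ^ n` fixes `E[ℓ ^ (n + 1)]`, so that `ψ = -ψ` on that group, and `ψ` and `D` would kill
it for all `n` (`not_anticommute`). So the conjugate is `ψ`, and comparing derivatives `σ r = r`.

Since `[F(E[ℓ]) : F(μ_ℓ)]` is odd and `r ^ 2 ∈ F`, in fact `r ∈ F(μ_ℓ)`. The quadratic Gauss sum `g`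
is an element of `F(μ_ℓ)` with `g ^ 2 = ± ℓ`. The extension `F(μ_ℓ) / F` is cyclic, so one of `r`,
`g` and `r g` is in `F` (`mem_bot_or_mul_mem_bot`). As `F` has odd degree, a rational number that is
a square in `F` is the square of a rational number. This excludes `g ∈ F`, because `± ℓ` is not such
a square, and also `r ∈ F`, because `-D` is negative and `r ^ 2 = D` is possible only if `D` is not
a square. Hence `D ℓ` is the square of a rational number, `K = ℚ(√-D) = ℚ(√-ℓ)`, and `ℓ` divides its
discriminant (`dvd_discr_of_sq_eq_neg`).

Two facts about `E` need an elementary substitute for the theory of division polynomials. The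
`x`-coordinate of `n • P` is a rational function of that of `P`, equal to `x / n ^ 2 + O(1)` at
infinity (`exists_isSmulX`); this yields the divisibility of the group of points (`smul_surjective`)
and the derivative of multiplication by `n` up to sign (`IsTangent.sq_of_smul`). If there were no
`ℓ`-torsion, this rational function would be a linear polynomial with linear coefficient
`1 / ℓ ^ 2` that fixes the `x`-coordinates of the three points of order two (`exists_torsion`).

Derivatives at infinity are treated as limits, for the absolute value that an embedding of the
algebraic closure into `ℂ` provides. The notion `IsTangent` itself is algebraic, so that Galois
automorphisms, which are not continuous, act on it.
-/

noncomputable section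

namespace EllipticCM

open scoped Classical

universe u v

section

open Polynomial WeierstrassCurve

/-! ### Multiplication on the x-coordinate -/

/-- `p = c X ^ m + (lower terms)`, where `c = 0` is allowed. -/
def HasLead {k : Type u} [Field k] (p : k[X]) (m : ℕ) (c : k) : Prop :=
  p.natDegree ≤ m ∧ p.coeff m = c

namespace HasLead

variable {k : Type u} [Field k] {p q : k[X]} {m n : ℕ} {a b : k}

lemma add (hp : HasLead p m a) (hq : HasLead q m b) : HasLead (p + q) m (a + b) :=
  ⟨natDegree_add_le_of_degree_le hp.1 hq.1, by rw [coeff_add, hp.2, hq.2]⟩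

lemma sub (hp : HasLead p m a) (hq : HasLead q m b) : HasLead (p - q) m (a - b) :=
  ⟨natDegree_sub_le_of_le hp.1 hq.1 |>.trans (max_self m).le, by rw [coeff_sub, hp.2, hq.2]⟩

lemma mul (hp : HasLead p m a) (hq : HasLead q n b) : HasLead (p * q) (m + n) (a * b) :=
  ⟨natDegree_mul_le_of_le hp.1 hq.1, by
    rw [coeff_mul_add_eq_of_natDegree_le hp.1 hq.1, hp.2, hq.2]⟩

lemma const (a : k) : HasLead (C a) 0 a := ⟨by simp, by simp⟩

lemma X : HasLead (X : k[X]) 1 1 := ⟨natDegree_X_le, coeff_X_one⟩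

lemma pow (hp : HasLead p m a) (n : ℕ) : HasLead (p ^ n) (n * m) (a ^ n) :=
  ⟨natDegree_pow_le_of_le n hp.1, by rw [coeff_pow_of_natDegree_le hp.1, hp.2]⟩

lemma of_lt (hp : HasLead p m a) (h : m < n) : HasLead p n 0 :=
  ⟨hp.1.trans h.le, coeff_eq_zero_of_natDegree_lt (hp.1.trans_lt h)⟩

lemma ne_zero (hp : HasLead p m a) (ha : a ≠ 0) : p ≠ 0 := by
  rintro rfl
  exact ha (by simpa using hp.2.symm)

lemma natDegree_eq (hp : HasLead p m a) (ha : a ≠ 0) : p.natDegree = m :=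
  le_antisymm hp.1 (le_natDegree_of_ne_zero (hp.2 ▸ ha))

lemma leadingCoeff_eq (hp : HasLead p m a) (ha : a ≠ 0) : p.leadingCoeff = a := by
  rw [leadingCoeff, hp.natDegree_eq ha, hp.2]

lemma cast (hp : HasLead p m a) (hm : m = n) (hab : a = b) : HasLead p n b := hm ▸ hab ▸ hp

end HasLead

section Rational

variable {k : Type u} [Field k] {W : WeierstrassCurve k}

/-- The sum `x(P + Q) + x(P - Q)` is a rational function of `x(P)` and `x(Q)`. -/
lemma addX_add_addX_negY {x₁ y₁ x₂ y₂ : k} (h₁ : W.toAffine.Equation x₁ y₁)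
    (h₂ : W.toAffine.Equation x₂ y₂) (hx : x₁ ≠ x₂) :
    (W.toAffine.addX x₁ x₂ (W.toAffine.slope x₁ x₂ y₁ y₂) +
      W.toAffine.addX x₁ x₂ (W.toAffine.slope x₁ x₂ y₁ (W.toAffine.negY x₂ y₂))) * (x₁ - x₂) ^ 2 =
    2 * x₁ * x₂ * (x₁ + x₂) + W.b₂ * x₁ * x₂ + W.b₄ * (x₁ + x₂) + W.b₆ := by
  have hx' := sub_ne_zero.mpr hx
  rw [Affine.slope_of_X_ne hx, Affine.slope_of_X_ne hx, Affine.addX, Affine.addX, Affine.negY,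
    b₂, b₄, b₆]
  rw [Affine.equation_iff] at h₁ h₂
  field_simp
  linear_combination 2 * h₁ + 2 * h₂

/-- The duplication formula for `x(2 • P)`. -/
lemma addX_self {x y : k} (h : W.toAffine.Equation x y) (hy : y ≠ W.toAffine.negY x y) :
    W.toAffine.addX x x (W.toAffine.slope x x y y) * (W.Ψ₂Sq.eval x) =
      x ^ 4 - W.b₄ * x ^ 2 - 2 * W.b₆ * x - W.b₈ := by
  have hs := div_mul_cancel₀ (3 * x ^ 2 + 2 * W.a₂ * x + W.a₄ - W.a₁ * y) (sub_ne_zero.mpr hy)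
  rw [← Affine.slope_of_Y_ne rfl hy, Affine.negY] at hs
  rw [Affine.equation_iff] at h
  have hψ : W.Ψ₂Sq.eval x = (y - (-y - W.a₁ * x - W.a₃)) ^ 2 := by
    simp only [Ψ₂Sq, b₂, b₄, b₆, eval_add, eval_mul, eval_C, eval_pow, eval_X]
    linear_combination - 4 * h
  rw [hψ, Affine.addX]
  generalize W.toAffine.slope x x y y = s at hs ⊢
  simp only [b₄, b₆, b₈]
  linear_combination (s * (y - (-y - W.a₁ * x - W.a₃)) +
    (3 * x ^ 2 + 2 * W.a₂ * x + W.a₄ - W.a₁ * y) + W.a₁ * (y - (-y - W.a₁ * x - W.a₃))) * hs -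
    (W.a₁ ^ 2 + 8 * x + 4 * W.a₂) * h

/-- Away from the zeros of `q`, the `x`-coordinate of `n • P` is the rational function `N / D` of
the `x`-coordinate of `P`; at infinity this function is `x / n ^ 2 + O(1)`. -/
structure IsSmulX (W : WeierstrassCurve k) (n : ℕ) (N D q : k[X]) (d : ℕ) (c : k) : Prop where
  q_ne_zero : q ≠ 0
  c_ne_zero : c ≠ 0
  lead_num : HasLead N (d + 1) c
  lead_den : HasLead D d (n ^ 2 * c)
  spec : ∀ (x y : k) (h : W.toAffine.Nonsingular x y), q.eval x ≠ 0 → D.eval x ≠ 0 ∧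
    ∃ (x' y' : k) (h' : W.toAffine.Nonsingular x' y'),
      n • (Affine.Point.some x y h : W.toAffine.Point) = .some x' y' h' ∧
        x' * D.eval x = N.eval x

lemma isSmulX_one (W : WeierstrassCurve k) : IsSmulX W 1 X 1 1 0 1 where
  q_ne_zero := one_ne_zero
  c_ne_zero := one_ne_zero
  lead_num := .X
  lead_den := (HasLead.const 1).cast rfl (by simp)
  spec x y h _ := ⟨by simp, x, y, h, one_smul _ _, by simp⟩

variable [CharZero k]

lemma isSmulX_two (W : WeierstrassCurve k) :
    ∃ N D q d c, IsSmulX W 2 N D q d c := by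
  have hD : HasLead W.Ψ₂Sq 3 4 := ⟨W.natDegree_Ψ₂Sq_le, W.coeff_Ψ₂Sq⟩
  refine ⟨X ^ 4 - C W.b₄ * X ^ 2 - C (2 * W.b₆) * X - C W.b₈, W.Ψ₂Sq, W.Ψ₂Sq, 3, 1,
    hD.ne_zero (by norm_num), one_ne_zero, ?_, hD.cast rfl (by norm_num), fun x y h hq ↦ ⟨hq, ?_⟩⟩
  · have h4 : HasLead (X ^ 4 : k[X]) 4 1 := (HasLead.X.pow 4).cast rfl (by simp)
    have h2 : HasLead (C W.b₄ * X ^ 2 : k[X]) 4 0 :=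
      ((HasLead.const _).mul (HasLead.X.pow 2)).of_lt (by norm_num)
    have h1 : HasLead (C (2 * W.b₆) * X : k[X]) 4 0 :=
      ((HasLead.const _).mul HasLead.X).of_lt (by norm_num)
    have h0 : HasLead (C W.b₈ : k[X]) 4 0 := (HasLead.const _).of_lt (by norm_num)
    exact (((h4.sub h2).sub h1).sub h0).cast rfl (by simp)
  · have hy : y ≠ W.toAffine.negY x y := by
      intro hy
      apply hq
      have h' := h.1
      rw [Affine.equation_iff] at h'
      rw [Affine.negY] at hy
      simp only [Ψ₂Sq, b₂, b₄, b₆, eval_add, eval_mul, eval_C, eval_pow, eval_X]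
      linear_combination - 4 * h' + (2 * y + W.a₁ * x + W.a₃) * hy
    refine ⟨_, _, _, (two_smul ℕ _).trans (Affine.Point.add_self_of_Y_ne hy), ?_⟩
    rw [addX_self h.1 hy]
    simp

/-- From `x(n • P)` and `x((n + 1) • P)` to `x((n + 2) • P)`, by the formula for
`x(Q + P) + x(Q - P)` with `Q = (n + 1) • P`. With leading behaviours `x / n ^ 2` and
`x / (n + 1) ^ 2` this formula yields `x / (n + 2) ^ 2`. -/
lemma IsSmulX.succ {n : ℕ} (hn : 1 ≤ n) {N D q N' D' q' : k[X]} {d d' : ℕ} {c c' : k}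
    (h : IsSmulX W (n + 1) N D q d c) (h' : IsSmulX W n N' D' q' d' c') :
    ∃ N D q d c, IsSmulX W (n + 2) N D q d c := by
  -- `M / D` is `x(Q) - x(P)`, and `A / M ^ 2` is `x(Q + P) + x(Q - P)`
  set M := N - X * D with hM
  have hn0 : (n : k) ≠ 0 := Nat.cast_ne_zero.mpr (by omega)
  have hn2 : (n : k) + 2 ≠ 0 := by exact_mod_cast (by omega : n + 2 ≠ 0)
  have lXD : HasLead (X * D) (d + 1) ((n + 1) ^ 2 * c) :=
    (HasLead.X.mul h.lead_den).cast (add_comm _ _) (by push_cast; ring)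
  have lM : HasLead M (d + 1) (- (n * (n + 2) * c)) :=
    (h.lead_num.sub lXD).cast rfl (by ring)
  have lN := h.lead_num
  have lD := h.lead_den
  set A := C 2 * (N * X * (N + X * D)) + C W.b₂ * (N * X * D) + C W.b₄ * ((N + X * D) * D)
    + C W.b₆ * D ^ 2 with hA
  have lA : HasLead A (2 * d + 3) (2 * (c ^ 2 * (1 + (n + 1) ^ 2))) := by
    refine (((((HasLead.const 2).mul ((lN.mul HasLead.X).mul (lN.add lXD))).cast
      (n := 2 * d + 3) (by ring) rfl).add (((HasLead.const _).mul ((lN.mul .X).mul lD)).of_lt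
      ?_)).add (((HasLead.const _).mul ((lN.add lXD).mul lD)).of_lt ?_)).add
      (((HasLead.const _).mul (lD.pow 2)).of_lt ?_) |>.cast rfl (by ring)
    all_goals omega
  refine ⟨A * D' - N' * M ^ 2, M ^ 2 * D', q * q' * M, 2 * (d + 1) + d', n ^ 4 * c ^ 2 * c',
    mul_ne_zero (mul_ne_zero h.q_ne_zero h'.q_ne_zero) (lM.ne_zero ?_), ?_, ?_, ?_, ?_⟩
  · simp [hn0, hn2, h.c_ne_zero]
  · simp [hn0, h.c_ne_zero, h'.c_ne_zero]
  · exact ((lA.mul h'.lead_den).cast (by ring) rfl).sub ((h'.lead_num.mul (lM.pow 2)).cast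
      (by ring) rfl) |>.cast rfl (by ring)
  · exact ((lM.pow 2).mul h'.lead_den).cast rfl (by push_cast; ring)
  · intro x y hxy hq
    simp only [eval_mul, mul_ne_zero_iff] at hq
    obtain ⟨⟨hq1, hq2⟩, hM0⟩ := hq
    obtain ⟨hD, x₁, y₁, h₁, e₁, r₁⟩ := h.spec x y hxy hq1
    obtain ⟨hD', x₂, y₂, h₂, e₂, r₂⟩ := h'.spec x y hxy hq2
    have hMe : M.eval x = (x₁ - x) * D.eval x := by
      simp only [hM, eval_sub, eval_mul, eval_X]
      linear_combination - r₁
    have hx : x₁ ≠ x := by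
      rintro rfl
      simp [hMe] at hM0
    have e := Affine.Point.add_of_X_ne (h₁ := h₁) (h₂ := hxy) hx
    rw [← e₁, ← succ_nsmul] at e
    refine ⟨by simp [hM0, hD'], _, _, _, e, ?_⟩
    · have e₃ : (Affine.Point.some x₁ y₁ h₁ : W.toAffine.Point) + - .some x y hxy =
          .some x₂ y₂ h₂ := by
        rw [← e₁, ← e₂, add_smul, one_smul, add_neg_cancel_right]
      rw [Affine.Point.neg_some, Affine.Point.add_of_X_ne hx] at e₃
      have e₄ := (Affine.Point.some.inj e₃).1
      have key := addX_add_addX_negY h₁.1 hxy.1 hx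
      rw [e₄] at key
      simp only [eval_sub, eval_mul, eval_pow, hMe, hA, eval_add, eval_X, eval_C, ← r₁, ← r₂]
      linear_combination (D.eval x) ^ 2 * D'.eval x * key

/-- The `x`-coordinate of `n • P` is a rational function of the `x`-coordinate of `P`. -/
lemma exists_isSmulX (W : WeierstrassCurve k) {n : ℕ} (hn : 1 ≤ n) :
    ∃ N D q d c, IsSmulX W n N D q d c := by
  suffices H : ∀ m : ℕ, (∃ N D q d c, IsSmulX W (m + 1) N D q d c) ∧
      ∃ N D q d c, IsSmulX W (m + 2) N D q d c by
    simpa [Nat.sub_add_cancel hn] using (H (n - 1)).1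
  intro m
  induction m with
  | zero => exact ⟨⟨_, _, _, _, _, isSmulX_one W⟩, isSmulX_two W⟩
  | succ m ih =>
    obtain ⟨⟨_, _, _, _, _, h₁⟩, h₂⟩ := ih
    refine ⟨h₂, ?_⟩
    obtain ⟨_, _, _, _, _, h₂⟩ := h₂
    exact h₂.succ (by omega) h₁

end Rational

end

section

open scoped Topology
open Polynomial WeierstrassCurve Filter

/-! ### Divisibility and torsion -/

section Torsion

variable {k : Type u} [Field k] {W : WeierstrassCurve k}

/-- The rational function `x(n • P)` in lowest terms. -/
lemma IsSmulX.exists_isCoprime {n : ℕ} {N D q : k[X]} {d : ℕ} {c : k}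
    (h : IsSmulX W n N D q d c) (hn : (n : k) ≠ 0) :
    ∃ N' D' d' c', IsSmulX W n N' D' q d' c' ∧ IsCoprime N' D' := by
  have hc := h.c_ne_zero
  have hD0 : D ≠ 0 := h.lead_den.ne_zero (by simp [hn, hc])
  have hN0 : N ≠ 0 := h.lead_num.ne_zero hc
  obtain ⟨N', hN'⟩ := EuclideanDomain.gcd_dvd_left N D
  obtain ⟨D', hD'⟩ := EuclideanDomain.gcd_dvd_right N D
  have hbez := EuclideanDomain.gcd_eq_gcd_ab N D
  set g := EuclideanDomain.gcd N D
  have hg : g ≠ 0 := by rintro h0; simp [h0] at hN'; exact hN0 hN'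
  have hN'0 : N' ≠ 0 := by rintro rfl; simp at hN'; exact hN0 hN'
  have hD'0 : D' ≠ 0 := by rintro rfl; simp at hD'; exact hD0 hD'
  have dN : g.natDegree + N'.natDegree = d + 1 := by
    rw [← natDegree_mul hg hN'0, ← hN', h.lead_num.natDegree_eq hc]
  have dD : g.natDegree + D'.natDegree = d := by
    rw [← natDegree_mul hg hD'0, ← hD', h.lead_den.natDegree_eq (by simp [hn, hc])]
  have lN : g.leadingCoeff * N'.leadingCoeff = c := by
    rw [← leadingCoeff_mul, ← hN', h.lead_num.leadingCoeff_eq hc]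
  have lD : g.leadingCoeff * D'.leadingCoeff = n ^ 2 * c := by
    rw [← leadingCoeff_mul, ← hD', h.lead_den.leadingCoeff_eq (by simp [hn, hc])]
  have hg' : g.leadingCoeff ≠ 0 := leadingCoeff_ne_zero.mpr hg
  refine ⟨N', D', D'.natDegree, N'.leadingCoeff, ⟨h.q_ne_zero, leadingCoeff_ne_zero.mpr hN'0,
    HasLead.cast ⟨le_rfl, rfl⟩ (by omega) rfl, HasLead.cast ⟨le_rfl, rfl⟩ rfl ?_, ?_⟩,
    ⟨EuclideanDomain.gcdA N D, EuclideanDomain.gcdB N D, ?_⟩⟩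
  · change D'.leadingCoeff = _
    apply mul_left_cancel₀ hg'
    rw [lD, ← lN]
    ring
  · intro x y hxy hq
    obtain ⟨hDx, x', y', h', e, r⟩ := h.spec x y hxy hq
    rw [hD', eval_mul] at hDx
    rw [hD', hN', eval_mul, eval_mul] at r
    refine ⟨right_ne_zero_of_mul hDx, x', y', h', e, mul_left_cancel₀ (left_ne_zero_of_mul hDx) ?_⟩
    linear_combination r
  · apply mul_left_cancel₀ hg
    linear_combination - hbez - EuclideanDomain.gcdA N D * hN' - EuclideanDomain.gcdB N D * hD'

lemma eq_or_eq_neg_of_x {x y y' : k} (h : W.toAffine.Nonsingular x y)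
    (h' : W.toAffine.Nonsingular x y') : (Affine.Point.some x y h : W.toAffine.Point) =
      .some x y' h' ∨ (Affine.Point.some x y h : W.toAffine.Point) = -.some x y' h' :=
  Affine.Point.X_eq_iff.mp rfl

/-- Outside a finite set of values `a`, the roots `r` of `N - a D` lie in the domain where the
formula `x(n • P) = N / D` holds, so `n • P` has `x`-coordinate `a` for the points above `r`. -/
lemma IsSmulX.exists_finite {n : ℕ} {N D q : k[X]} {d : ℕ} {c : k}
    (h : IsSmulX W n N D q d c) (hco : IsCoprime N D) :
    ∃ S : Set k, S.Finite ∧ ∀ a ∉ S, ∀ r, (N - C a * D).eval r = 0 → D.eval r ≠ 0 ∧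
      ∀ y (hy : W.toAffine.Nonsingular r y), ∃ y' h',
        n • (Affine.Point.some r y hy : W.toAffine.Point) = .some a y' h' := by
  refine ⟨(fun r ↦ N.eval r / D.eval r) '' {r | q.eval r = 0},
    (q.finite_setOfPred_isRoot h.q_ne_zero).image _, fun a ha r hr ↦ ?_⟩
  simp only [eval_sub, eval_mul, eval_C] at hr
  have hD : D.eval r ≠ 0 := by
    intro hD
    obtain ⟨s, t, hst⟩ := hco
    have := congrArg (eval r) hst
    simp only [eval_add, eval_mul, eval_one, hD] at this
    rw [hD] at hr
    simp [show N.eval r = 0 by simpa using hr] at this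
  have hq : q.eval r ≠ 0 := fun hq ↦ ha ⟨r, hq, by
    simp only
    rw [div_eq_iff hD]; linear_combination hr⟩
  refine ⟨hD, fun y hy ↦ ?_⟩
  obtain ⟨_, x', y', h', e, e'⟩ := h.spec r y hy hq
  obtain rfl : x' = a := mul_right_cancel₀ hD (by linear_combination e' + hr)
  exact ⟨y', h', e⟩

/-- On the curve, `Ψ₂Sq` is the square of `y - negY`, which vanishes at the points of order two. -/
lemma psi₂Sq_eval {x y : k} (h : W.toAffine.Equation x y) :
    W.Ψ₂Sq.eval x = (2 * y + W.a₁ * x + W.a₃) ^ 2 := by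
  rw [Affine.equation_iff] at h
  simp only [Ψ₂Sq, b₂, b₄, b₆, eval_add, eval_mul, eval_C, eval_pow, eval_X]
  linear_combination - 4 * h

section IsAlgClosed

variable [IsAlgClosed k] [W.IsElliptic]

variable (W) in
lemma exists_nonsingular (x : k) : ∃ y, W.toAffine.Nonsingular x y := by
  obtain ⟨y, hy⟩ := IsAlgClosed.exists_root
    (X ^ 2 + C (W.a₁ * x + W.a₃) * X - C (x ^ 3 + W.a₂ * x ^ 2 + W.a₄ * x + W.a₆)) (by
      have : (X ^ 2 + C (W.a₁ * x + W.a₃) * X -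
        C (x ^ 3 + W.a₂ * x ^ 2 + W.a₄ * x + W.a₆)).degree = 2 := by compute_degree!
      rw [this]; decide)
  refine ⟨y, Affine.equation_iff_nonsingular.mp ((Affine.equation_iff ..).mpr ?_)⟩
  simp only [IsRoot, eval_sub, eval_add, eval_mul, eval_pow, eval_X, eval_C] at hy
  linear_combination hy

variable (W) in
/-- A chosen `y`-coordinate above `x`. -/
def yAbove (x : k) : k := (exists_nonsingular W x).choose

variable (W) in
lemma nonsingular_yAbove (x : k) : W.toAffine.Nonsingular x (yAbove W x) :=
  (exists_nonsingular W x).choose_spec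

variable (W) in
/-- A chosen point with `x`-coordinate `x`. -/
def ptAbove (x : k) : W.toAffine.Point := .some x _ (nonsingular_yAbove W x)

lemma ptAbove_injective : Function.Injective (ptAbove W) := fun _ _ h ↦
  (Affine.Point.some.inj h).1

lemma infinite_point : Infinite W.toAffine.Point := Infinite.of_injective _ ptAbove_injective

lemma finite_setOf_x_mem {S : Set k} (hS : S.Finite) :
    {P : W.toAffine.Point | ∀ x y h, P = .some x y h → x ∈ S}.Finite := by
  refine ((Set.finite_singleton 0).union ((hS.image (ptAbove W)).union
    (hS.image fun x ↦ - ptAbove W x))).subset ?_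
  rintro (_ | ⟨x, y, h⟩) hP
  · exact Or.inl rfl
  · have hx : x ∈ S := hP x y h rfl
    rcases eq_or_eq_neg_of_x h (nonsingular_yAbove W x) with e | e
    · exact Or.inr (Or.inl ⟨x, hx, e.symm⟩)
    · exact Or.inr (Or.inr ⟨x, hx, e.symm⟩)

lemma two_mul_add_eq_zero {e : k} (he : W.Ψ₂Sq.eval e = 0) :
    2 * yAbove W e + W.a₁ * e + W.a₃ = 0 := by
  rw [psi₂Sq_eval (nonsingular_yAbove W e).1] at he
  exact pow_eq_zero_iff two_ne_zero |>.mp he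

variable [CharZero k]

/-- Multiplication by `n ≠ 0` is surjective: the image is a subgroup containing all but finitely
many points. -/
lemma smul_surjective {n : ℕ} (hn : 1 ≤ n) (T : W.toAffine.Point) :
    ∃ P : W.toAffine.Point, n • P = T := by
  obtain ⟨_, _, _, _, _, h₀⟩ := exists_isSmulX W hn
  have hn0 : (n : k) ≠ 0 := Nat.cast_ne_zero.mpr (by omega)
  obtain ⟨N, D, d, c, h, hco⟩ := h₀.exists_isCoprime hn0
  obtain ⟨S, hS, hS'⟩ := h.exists_finite hco
  have key : ∀ Q : W.toAffine.Point, ¬ (∀ x y h, Q = .some x y h → x ∈ S) →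
      Q ∈ (nsmulAddMonoidHom (α := W.toAffine.Point) n).range := by
    intro Q hQ
    push Not at hQ
    obtain ⟨a, y, hy, rfl, ha⟩ := hQ
    have hlead : HasLead (N - C a * D) (d + 1) c :=
      (h.lead_num.sub (((HasLead.const a).mul h.lead_den).of_lt (by omega))).cast rfl (by simp)
    obtain ⟨r, hr⟩ := IsAlgClosed.exists_root (N - C a * D) (by
      rw [degree_eq_natDegree (hlead.ne_zero h.c_ne_zero), hlead.natDegree_eq h.c_ne_zero]
      exact_mod_cast d.succ_ne_zero)
    obtain ⟨_, hP⟩ := hS' a ha r hr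
    obtain ⟨y', h', e⟩ := hP _ (nonsingular_yAbove W r)
    rcases eq_or_eq_neg_of_x hy h' with e' | e'
    · exact ⟨ptAbove W r, e.trans e'.symm⟩
    · refine ⟨-ptAbove W r, ?_⟩
      rw [map_neg, e', neg_inj]
      exact e
  -- `T` is the sum of two points outside the finite exceptional set
  have hfin := finite_setOf_x_mem (W := W) hS
  have := infinite_point (W := W)
  obtain ⟨Q, hQ⟩ := (hfin.union (hfin.image (fun Q ↦ T - Q))).exists_notMem
  rw [Set.mem_union, not_or] at hQ
  obtain ⟨R, hR⟩ := add_mem (key Q hQ.1) (key (T - Q) fun hT ↦ hQ.2 ⟨T - Q, hT, by simp⟩)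
  exact ⟨R, hR.trans (by abel)⟩

/-- The polynomial `4x³ + b₂x² + 2b₄x + b₆` of the `2`-torsion points has two distinct roots. -/
lemma exists_two_roots (W : WeierstrassCurve k) [W.IsElliptic] :
    ∃ e₁ e₂ : k, e₁ ≠ e₂ ∧ W.Ψ₂Sq.eval e₁ = 0 ∧ W.Ψ₂Sq.eval e₂ = 0 := by
  have ha : W.twoTorsionPolynomial.a ≠ 0 := by
    simp [twoTorsionPolynomial]
  obtain ⟨x, y, z, h⟩ := (Cubic.splits_iff_roots_eq_three (φ := RingHom.id k) ha).mp
    (IsAlgClosed.splits _)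
  have hne := (Cubic.discr_ne_zero_iff_roots_ne ha h).mp
    (W.twoTorsionPolynomial_discr_ne_zero_of_isElliptic (IsUnit.mk0 _ two_ne_zero))
  rw [Cubic.map_roots, Polynomial.map_id, ← W.Ψ₂Sq_eq] at h
  refine ⟨x, y, hne.1, ?_, ?_⟩
  · exact (mem_roots'.mp (by rw [h]; simp)).2
  · exact (mem_roots'.mp (by rw [h]; simp)).2

/-- If multiplication by `n > 1` is injective, then `x(n • P)` is a linear polynomial in `x(P)`:
otherwise `N - a D` would have a multiple root for almost all `a`, and the Wronskian of `N` and `D`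
would vanish. -/
lemma IsSmulX.linear_of_injective {n : ℕ} (hn : 1 ≤ n) {N D q : k[X]} {d : ℕ} {c : k}
    (h : IsSmulX W n N D q d c) (hco : IsCoprime N D)
    (hinj : ∀ P : W.toAffine.Point, n • P = 0 → P = 0) : d = 0 := by
  by_contra hd
  obtain ⟨e, rfl⟩ := Nat.exists_eq_succ_of_ne_zero hd
  have hn0 : (n : k) ≠ 0 := Nat.cast_ne_zero.mpr (by omega)
  have hc := h.c_ne_zero
  obtain ⟨S, hS, hS'⟩ := h.exists_finite hco
  have hder : ∀ {p : k[X]} {m : ℕ} {a : k}, HasLead p (m + 1) a →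
      HasLead (derivative p) m (a * (m + 1)) := fun {p m a} hp ↦
    ⟨(natDegree_derivative_le p).trans (by have := hp.1; omega), by rw [coeff_derivative, hp.2]⟩
  have hlead : ∀ a, HasLead (N - C a * D) (e + 1 + 1) c := fun a ↦
    (h.lead_num.sub (((HasLead.const a).mul h.lead_den).of_lt (by omega))).cast rfl (by simp)
  set V := derivative N * D - N * derivative D
  -- the leading coefficient of `V` is `n ^ 2 c ^ 2 ((e + 2) - (e + 1))`
  have hV : V ≠ 0 := by
    refine HasLead.ne_zero (m := 2 * e + 2) (a := n ^ 2 * c ^ 2) ?_ (by simp [hn0, hc])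
    exact (((hder h.lead_num).mul h.lead_den).cast (n := 2 * e + 2) (by omega) rfl).sub
      ((h.lead_num.mul (hder h.lead_den)).cast (by omega) rfl) |>.cast rfl (by push_cast; ring)
  have key : ∀ a ∉ S, ∃ r, V.eval r = 0 ∧ N.eval r / D.eval r = a := by
    intro a ha
    set p := N - C a * D with hp
    have hp0 : p ≠ 0 := (hlead a).ne_zero hc
    -- points above two roots have images equal up to sign, so by injectivity the roots agree
    have huniq : ∀ r s, p.eval r = 0 → p.eval s = 0 → r = s := by
      intro r s hr hs
      obtain ⟨_, hP⟩ := hS' a ha r hr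
      obtain ⟨_, hQ⟩ := hS' a ha s hs
      obtain ⟨y, h₁, e₁⟩ := hP _ (nonsingular_yAbove W r)
      obtain ⟨z, h₂, e₂⟩ := hQ _ (nonsingular_yAbove W s)
      refine (Affine.Point.X_eq_iff (h₁ := nonsingular_yAbove W r)
        (h₂ := nonsingular_yAbove W s)).mpr ?_
      rcases eq_or_eq_neg_of_x h₁ h₂ with e' | e'
      · left
        rw [← sub_eq_zero]
        apply hinj
        rw [smul_sub, e₁, e₂, e', sub_self]
      · right
        rw [← sub_eq_zero]
        apply hinj
        rw [smul_sub, smul_neg, e₁, e₂, e', sub_self]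
    have hcard : p.roots.card = e + 1 + 1 := by
      rw [IsAlgClosed.card_roots_eq_natDegree, (hlead a).natDegree_eq hc]
    obtain ⟨r, hr⟩ := Multiset.card_pos_iff_exists_mem.mp (by rw [hcard]; omega)
    have hr' := (mem_roots'.mp hr).2
    have hrep : p.roots = Multiset.replicate (e + 1 + 1) r := Multiset.eq_replicate.mpr
      ⟨hcard, fun b hb ↦ huniq _ _ (mem_roots'.mp hb).2 hr'⟩
    have hmult : 1 < rootMultiplicity r p := by
      rw [← count_roots, hrep, Multiset.count_replicate_self]; omega
    have hder0 := ((one_lt_rootMultiplicity_iff_isRoot hp0).mp hmult).2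
    obtain ⟨hD, _⟩ := hS' a ha r hr'
    simp only [hp, IsRoot, derivative_sub, derivative_C_mul, eval_sub, eval_mul, eval_C]
      at hr' hder0
    refine ⟨r, ?_, by rw [div_eq_iff hD]; linear_combination hr'⟩
    simp only [V, eval_sub, eval_mul]
    linear_combination D.eval r * hder0 - (derivative D).eval r * hr'
  have hfin : Sᶜ.Finite := ((V.finite_setOfPred_isRoot hV).image
    (fun r ↦ N.eval r / D.eval r)).subset fun a ha ↦ key a ha
  exact Set.infinite_univ (α := k) (by simpa using hS.union hfin)

end IsAlgClosed

end Torsion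

/-! ### Nontrivial torsion of odd order -/

section Continuity

variable {k : Type u} [NontriviallyNormedField k] {W : WeierstrassCurve k}

lemma tendsto_zero_of_sq {α : Type*} {l : Filter α} {f : α → k}
    (h : Tendsto (fun x ↦ f x ^ 2) l (𝓝 0)) : Tendsto f l (𝓝 0) := by
  rw [tendsto_zero_iff_norm_tendsto_zero] at h ⊢
  simpa [Function.comp_def, Real.sqrt_sq (norm_nonneg _)] using
    (Real.continuous_sqrt.tendsto 0).comp (h.congr fun x ↦ norm_pow (f x) 2)

variable [IsAlgClosed k] [CharZero k] [W.IsElliptic]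

/-- The two branches of `y` meet at a `2`-torsion point. -/
lemma tendsto_yAbove {e : k} (he : W.Ψ₂Sq.eval e = 0) :
    Tendsto (yAbove W) (𝓝 e) (𝓝 (yAbove W e)) := by
  have h3 : Tendsto (fun x ↦ 2 * yAbove W x + W.a₁ * x + W.a₃) (𝓝 e) (𝓝 0) :=
    tendsto_zero_of_sq <| (he ▸ W.Ψ₂Sq.continuous.tendsto e).congr fun x ↦
      psi₂Sq_eval (nonsingular_yAbove W x).1
  have h4 : Tendsto (fun x : k ↦ (W.a₁ * x + W.a₃)) (𝓝 e) (𝓝 (W.a₁ * e + W.a₃)) :=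
    Continuous.tendsto (by fun_prop) e
  have h5 := ((h3.sub h4).div_const 2)
  have h6 := two_mul_add_eq_zero (W := W) he
  convert h5 using 1
  · ext x
    field_simp
    ring
  · congr 1
    field_simp
    linear_combination h6

/-- A morphism given generically by `x ↦ N / D` on `x`-coordinates is still given by this formula
at a `2`-torsion point mapped to an affine point. -/
lemma IsMorphism.x_eq_at_two_torsion {φ : W.toAffine.Point → W.toAffine.Point}
    (hφ : IsMorphism W φ) {e e' y' : k} (he : W.Ψ₂Sq.eval e = 0)
    {h' : W.toAffine.Nonsingular e' y'} (hT : φ (ptAbove W e) = .some e' y' h')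
    {N D q : k[X]} (hq : q ≠ 0)
    (hspec : ∀ x y (h : W.toAffine.Nonsingular x y), q.eval x ≠ 0 →
      ∃ x' y' h', φ (.some x y h) = .some x' y' h' ∧ x' * D.eval x = N.eval x) :
    e' * D.eval e = N.eval e := by
  obtain ⟨d, A, -, ⟨i, hi⟩, hA⟩ := hφ (ptAbove W e)
  have hlim : ∀ j, Tendsto (fun x ↦ MvPolynomial.eval (projCoords (ptAbove W x)) (A j)) (𝓝 e)
      (𝓝 (MvPolynomial.eval (projCoords (ptAbove W e)) (A j))) := by
    intro j
    refine ((MvPolynomial.continuous_eval (A j)).tendsto _).comp ?_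
    rw [tendsto_pi_nhds]
    intro i
    fin_cases i
    · exact tendsto_id
    · exact tendsto_yAbove he
    · exact tendsto_const_nhds
  have hev : ∀ᶠ x in 𝓝[≠] e, q.eval x ≠ 0 := by
    have : {x | q.eval x ≠ 0} ∪ {e} ∈ 𝓝 e := by
      have hfin : ({x | q.eval x = 0} \ {e}).Finite := (q.finite_setOfPred_isRoot hq).subset
        Set.sdiff_subset
      filter_upwards [hfin.isClosed.isOpen_compl.mem_nhds (by simp : e ∈ _)] with x hx
      by_cases hxe : x = e
      · exact Or.inr hxe
      · exact Or.inl fun h0 ↦ hx ⟨h0, hxe⟩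
    rw [eventually_nhdsWithin_iff]
    filter_upwards [this] with x hx hxe
    exact hx.resolve_right hxe
  -- the local equations of `φ` and the formula `N / D` agree near `e`, hence also at `e`
  have heq : ∀ᶠ x in 𝓝[≠] e,
      MvPolynomial.eval (projCoords (ptAbove W x)) (A 0) * D.eval x =
        N.eval x * MvPolynomial.eval (projCoords (ptAbove W x)) (A 2) := by
    filter_upwards [hev] with x hx
    by_cases h0 : ∃ i, MvPolynomial.eval (projCoords (ptAbove W x)) (A i) ≠ 0
    · obtain ⟨c, hc⟩ := hA _ h0
      obtain ⟨x', y', h', e₁, e₂⟩ := hspec x _ (nonsingular_yAbove W x) hx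
      rw [hc 0, hc 2, ptAbove, e₁]
      simp only [projCoords, Matrix.cons_val]
      linear_combination c * e₂
    · push Not at h0
      rw [h0 0, h0 2]
      simp
  have h1 := ((hlim 0).mul (D.continuous.tendsto e)).mono_left (nhdsWithin_le_nhds (s := {e}ᶜ))
  have h2 := ((N.continuous.tendsto e).mul (hlim 2)).mono_left (nhdsWithin_le_nhds (s := {e}ᶜ))
  have h3 := tendsto_nhds_unique (h1.congr' heq) h2
  obtain ⟨c, hc⟩ := hA _ ⟨i, hi⟩
  have hc0 : c ≠ 0 := by
    rintro rfl
    simp [hc i] at hi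
  rw [hc 0, hc 2, hT] at h3
  simp only [projCoords, Matrix.cons_val] at h3
  apply mul_left_cancel₀ hc0
  linear_combination h3

/-- There is nontrivial `n`-torsion for every odd `n > 1`. Otherwise `x(n • P)` is a linear
polynomial of `x(P)` with linear coefficient `1 / n ^ 2`, but it fixes the `x`-coordinates of the
three points of order two. -/
lemma exists_torsion {n : ℕ} (hodd : Odd n) (hn : 1 < n)
    (hmor : IsMorphism W fun P ↦ n • P) :
    ∃ P : W.toAffine.Point, P ≠ 0 ∧ n • P = 0 := by
  by_contra! hinj
  have hn0 : (n : k) ≠ 0 := Nat.cast_ne_zero.mpr (by omega)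
  obtain ⟨_, _, q, _, _, h₀⟩ := exists_isSmulX W hn.le
  obtain ⟨N, D, d, c, h, hco⟩ := h₀.exists_isCoprime hn0
  obtain rfl := h.linear_of_injective hn.le hco fun P hP ↦ by
    by_contra hP0
    exact hinj P hP0 hP
  have hN := eq_X_add_C_of_natDegree_le_one h.lead_num.1
  have hD := eq_C_of_natDegree_le_zero h.lead_den.1
  rw [show N.coeff 1 = c from h.lead_num.2] at hN
  rw [h.lead_den.2] at hD
  have key : ∀ e, W.Ψ₂Sq.eval e = 0 → e * (n ^ 2 * c) = c * e + N.coeff 0 := by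
    intro e he
    have h2 : 2 • ptAbove W e = 0 := by
      rw [two_smul]
      apply Affine.Point.add_self_of_Y_eq
      rw [Affine.negY]
      linear_combination two_mul_add_eq_zero (W := W) he
    have hT : n • ptAbove W e = .some e _ (nonsingular_yAbove W e) := by
      obtain ⟨m, rfl⟩ := hodd
      rw [add_smul, mul_comm 2 m, mul_smul, h2, smul_zero, zero_add, one_smul, ptAbove]
    have := hmor.x_eq_at_two_torsion he hT h.q_ne_zero fun x y hxy hq ↦ (h.spec x y hxy hq).2
    rw [hD, hN] at this
    simpa using this
  obtain ⟨e₁, e₂, hne, he₁, he₂⟩ := exists_two_roots W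
  have h3 : ((n : k) ^ 2 - 1) * (c * (e₁ - e₂)) = 0 := by
    linear_combination key e₁ he₁ - key e₂ he₂
  have h4 : (n : k) ^ 2 = 1 := by
    have := h.c_ne_zero
    simpa [this, sub_ne_zero.mpr hne, sub_eq_zero] using h3
  have h5 : n ^ 2 = 1 := by exact_mod_cast h4
  have := (Nat.pow_eq_one.mp h5)
  omega

end Continuity

end

section

open scoped Topology
open WeierstrassCurve Filter Bornology

/-! ### Derivatives of endomorphisms at infinity -/

section Homogeneous

variable {k : Type u} [Field k]

lemma eval_smul_of_isHomogeneous {σ : Type*} {p : MvPolynomial σ k} {d : ℕ}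
    (hp : p.IsHomogeneous d) (c : k) (v : σ → k) :
    MvPolynomial.eval (c • v) p = c ^ d * MvPolynomial.eval v p := by
  rw [MvPolynomial.eval_eq, MvPolynomial.eval_eq, Finset.mul_sum]
  refine Finset.sum_congr rfl fun m hm ↦ ?_
  have h : m.degree = d := by
    rw [Finsupp.degree_eq_weight_one]
    exact hp (MvPolynomial.mem_support_iff.mp hm)
  simp only [Pi.smul_apply, smul_eq_mul, mul_pow, Finset.prod_mul_distrib]
  rw [Finset.prod_pow_eq_pow_sum, ← Finsupp.degree_apply, h]
  ring

end Homogeneous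

section Coordinates

variable {k : Type u} [Field k] {W : WeierstrassCurve k}

/-- The affine `x`-coordinate, with the value `0` at infinity. -/
def xCoord : W.toAffine.Point → k
  | .zero => 0
  | .some x _ _ => x

/-- The affine `y`-coordinate, with the value `0` at infinity. -/
def yCoord : W.toAffine.Point → k
  | .zero => 0
  | .some _ y _ => y

/-- The function `x / y`, a local parameter at infinity; its value at infinity is `0`. -/
def zCoord (P : W.toAffine.Point) : k := projCoords P 0 / projCoords P 1

@[simp] lemma zCoord_zero : zCoord (0 : W.toAffine.Point) = 0 := by
  simp [zCoord, projCoords]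

@[simp] lemma zCoord_some {x y : k} (h : W.toAffine.Nonsingular x y) :
    zCoord (Affine.Point.some x y h : W.toAffine.Point) = x / y := rfl

/-- `a` is the derivative at infinity, with respect to the parameter `x / y`, of the map `φ`: near
infinity `φ` is given by homogeneous polynomials `A` with `∂A₀/∂X = a A₁` at `[0 : 1 : 0]`. -/
def IsTangent (φ : W.toAffine.Point → W.toAffine.Point) (a : k) : Prop :=
  ∃ (d : ℕ) (A : Fin 3 → MvPolynomial (Fin 3) k),
    (∀ i, (A i).IsHomogeneous d) ∧ MvPolynomial.eval ![0, 1, 0] (A 1) ≠ 0 ∧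
    (∀ Q : W.toAffine.Point, (∃ i, MvPolynomial.eval (projCoords Q) (A i) ≠ 0) →
      ∃ c : k, ∀ i, MvPolynomial.eval (projCoords Q) (A i) = c * projCoords (φ Q) i) ∧
    a * MvPolynomial.eval ![0, 1, 0] (A 1) =
      MvPolynomial.eval ![0, 1, 0] (MvPolynomial.pderiv 0 (A 0))

lemma projCoords_zero : projCoords (0 : W.toAffine.Point) = ![0, 1, 0] := rfl

lemma IsMorphism.exists_isTangent {φ : W.toAffine.Point → W.toAffine.Point}
    (hφ : IsMorphism W φ) (h0 : φ 0 = 0) : ∃ a, IsTangent φ a := by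
  obtain ⟨d, A, hd, ⟨i, hi⟩, hA⟩ := hφ 0
  obtain ⟨c, hc⟩ := hA 0 ⟨i, hi⟩
  have h1 : MvPolynomial.eval ![0, 1, 0] (A 1) ≠ 0 := by
    rw [hc i] at hi
    have := hc 1
    rw [projCoords_zero] at this
    rw [this, h0]
    simpa [projCoords_zero] using left_ne_zero_of_mul hi
  exact ⟨_, d, A, hd, h1, hA, div_mul_cancel₀ _ h1⟩

end Coordinates

section Asymptotics

open Polynomial in
lemma HasLead.tendsto_cobounded {k : Type u} [NontriviallyNormedField k] {p : k[X]} {m : ℕ}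
    {c : k} (hp : HasLead p m c) : Tendsto (fun x ↦ p.eval x / x ^ m) (cobounded k) (𝓝 c) := by
  have hinv := tendsto_inv₀_cobounded (α := k)
  have h1 : Tendsto (fun x : k ↦ ∑ i ∈ Finset.range (m + 1), p.coeff i * (x⁻¹) ^ (m - i))
      (cobounded k) (𝓝 (∑ i ∈ Finset.range (m + 1), p.coeff i * 0 ^ (m - i))) :=
    tendsto_finsetSum _ fun i _ ↦ (hinv.pow _).const_mul _
  have h2 : ∑ i ∈ Finset.range (m + 1), p.coeff i * 0 ^ (m - i) = c := by
    rw [Finset.sum_range_succ, Finset.sum_eq_zero, Nat.sub_self, pow_zero, mul_one, zero_add, hp.2]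
    intro i hi
    rw [Finset.mem_range] at hi
    rw [zero_pow (by omega), mul_zero]
  rw [h2] at h1
  refine h1.congr' ?_
  filter_upwards [eventually_ne_cobounded (0 : k)] with x hx
  rw [eval_eq_sum_range' (Nat.lt_succ_of_le hp.1), Finset.sum_div]
  refine Finset.sum_congr rfl fun i hi ↦ ?_
  rw [Finset.mem_range] at hi
  obtain ⟨j, rfl⟩ := Nat.exists_eq_add_of_le (Nat.le_of_lt_succ hi)
  rw [Nat.add_sub_cancel_left, inv_pow, pow_add]
  field_simp

variable {k : Type u} [NontriviallyNormedField k] {W : WeierstrassCurve k}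

variable (W) in
/-- The filter of punctured neighbourhoods of infinity. -/
def atInfty : Filter W.toAffine.Point := comap yCoord (cobounded k)

lemma tendsto_yCoord : Tendsto yCoord (atInfty W) (cobounded k) := tendsto_comap

lemma eventually_exists_some : ∀ᶠ P in atInfty W, ∃ x y h, y ≠ 0 ∧ P = .some x y h := by
  filter_upwards [tendsto_yCoord.eventually (eventually_ne_cobounded 0)] with P hP
  rcases P with _ | ⟨x, y, h⟩
  · exact absurd rfl hP
  · exact ⟨x, y, h, hP, rfl⟩

/-- On the curve, `y` is bounded where `x` is. -/
lemma norm_y_le {x y : k} (h : W.toAffine.Equation x y) {M : ℝ} (hM : ‖x‖ ≤ M) :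
    ‖y‖ ≤ 1 + (M ^ 3 + ‖W.a₂‖ * M ^ 2 + ‖W.a₄‖ * M + ‖W.a₆‖) + (‖W.a₁‖ * M + ‖W.a₃‖) := by
  have hM0 : 0 ≤ M := (norm_nonneg x).trans hM
  rcases le_or_gt ‖y‖ 1 with hy | hy
  · have : 0 ≤ (M ^ 3 + ‖W.a₂‖ * M ^ 2 + ‖W.a₄‖ * M + ‖W.a₆‖) + (‖W.a₁‖ * M + ‖W.a₃‖) := by
      positivity
    linarith
  · rw [Affine.equation_iff] at h
    have e : y * y = (x ^ 3 + W.a₂ * x ^ 2 + W.a₄ * x + W.a₆) - (W.a₁ * x + W.a₃) * y := by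
      linear_combination h
    have h1 : ‖x ^ 3 + W.a₂ * x ^ 2 + W.a₄ * x + W.a₆‖ ≤
        M ^ 3 + ‖W.a₂‖ * M ^ 2 + ‖W.a₄‖ * M + ‖W.a₆‖ := by
      refine (norm_add_le _ _).trans (add_le_add ((norm_add_le _ _).trans (add_le_add
        ((norm_add_le _ _).trans (add_le_add ?_ ?_)) ?_)) le_rfl)
      · rw [norm_pow]; gcongr
      · rw [norm_mul, norm_pow]; gcongr
      · rw [norm_mul]; gcongr
    have h2 : ‖W.a₁ * x + W.a₃‖ ≤ ‖W.a₁‖ * M + ‖W.a₃‖ := by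
      refine (norm_add_le _ _).trans (add_le_add ?_ le_rfl)
      rw [norm_mul]; gcongr
    have h3 : ‖y‖ * ‖y‖ ≤ ‖x ^ 3 + W.a₂ * x ^ 2 + W.a₄ * x + W.a₆‖ +
        ‖W.a₁ * x + W.a₃‖ * ‖y‖ := by
      rw [← norm_mul, ← norm_mul, e]
      exact norm_sub_le _ _
    have h4 : 0 ≤ ‖x ^ 3 + W.a₂ * x ^ 2 + W.a₄ * x + W.a₆‖ := norm_nonneg _
    have h5 : ‖y‖ * ‖y‖ ≤ (‖x ^ 3 + W.a₂ * x ^ 2 + W.a₄ * x + W.a₆‖ +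
        ‖W.a₁ * x + W.a₃‖) * ‖y‖ := by nlinarith
    have := le_of_mul_le_mul_right h5 (by linarith)
    linarith

lemma tendsto_xCoord : Tendsto xCoord (atInfty W) (cobounded k) := by
  rw [← tendsto_norm_atTop_iff_cobounded, tendsto_atTop]
  intro M
  have h := tendsto_norm_atTop_iff_cobounded.mpr (tendsto_yCoord (W := W))
  filter_upwards [h.eventually (eventually_gt_atTop (1 + (M ^ 3 + ‖W.a₂‖ * M ^ 2 + ‖W.a₄‖ * M +
    ‖W.a₆‖) + (‖W.a₁‖ * M + ‖W.a₃‖))), eventually_exists_some] with P hP hP'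
  obtain ⟨x, y, hxy, -, rfl⟩ := hP'
  by_contra! hlt
  exact absurd (norm_y_le hxy.1 hlt.le) (not_le.mpr hP)

lemma tendsto_eval_xCoord {p : Polynomial k} {m : ℕ} {c : k} (hp : HasLead p m c) :
    Tendsto (fun P ↦ p.eval (xCoord P) / xCoord P ^ m) (atInfty W) (𝓝 c) :=
  hp.tendsto_cobounded.comp tendsto_xCoord

lemma eventually_xCoord_ne : ∀ᶠ P in atInfty W, xCoord P ≠ 0 :=
  tendsto_xCoord.eventually (eventually_ne_cobounded 0)

/-- Near infinity `y² ∼ x³`. -/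
lemma tendsto_y_sq_div [CharZero k] :
    Tendsto (fun P ↦ yCoord P ^ 2 / xCoord P ^ 3) (atInfty W) (𝓝 1) := by
  have h1 : Tendsto (fun P ↦ W.Ψ₂Sq.eval (xCoord P) / xCoord P ^ 3) (atInfty W) (𝓝 4) :=
    tendsto_eval_xCoord ⟨W.natDegree_Ψ₂Sq_le, W.coeff_Ψ₂Sq⟩
  have h2 : Tendsto (fun P ↦ (W.a₁ * xCoord P + W.a₃) ^ 2 / xCoord P ^ 3) (atInfty W) (𝓝 0) := by
    have hl : HasLead (.C W.a₁ * .X + .C W.a₃ : Polynomial k) 1 (W.a₁ + 0) :=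
      (((HasLead.const W.a₁).mul HasLead.X).cast (by omega) (mul_one _)).add
        ((HasLead.const W.a₃).of_lt one_pos)
    simpa using tendsto_eval_xCoord ((hl.pow 2).of_lt (show 2 * 1 < 3 by norm_num)) (W := W)
  have h3 : Tendsto (fun P ↦ (2 * yCoord P + W.a₁ * xCoord P + W.a₃) *
      (W.a₁ * xCoord P + W.a₃) / xCoord P ^ 3) (atInfty W) (𝓝 0) := by
    -- the square of this term is the product of the two terms before
    apply tendsto_zero_of_sq
    have := h1.mul h2
    rw [mul_zero] at this
    refine this.congr' ?_
    filter_upwards [eventually_exists_some] with P hP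
    obtain ⟨x, y, hxy, -, rfl⟩ := hP
    simp only [xCoord, yCoord]
    rw [psi₂Sq_eval hxy.1]
    ring
  have h4 := ((h1.sub (h3.const_mul 2)).add h2).div_const 4
  rw [mul_zero, sub_zero, add_zero, div_self (by norm_num)] at h4
  refine h4.congr' ?_
  filter_upwards [eventually_exists_some] with P hP
  obtain ⟨x, y, hxy, -, rfl⟩ := hP
  simp only [xCoord, yCoord]
  rw [psi₂Sq_eval hxy.1]
  ring

/-- Near infinity `x ∼ z⁻²`. -/
lemma tendsto_z_sq_mul_x [CharZero k] :
    Tendsto (fun P ↦ zCoord P ^ 2 * xCoord P) (atInfty W) (𝓝 1) := by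
  have := tendsto_y_sq_div (W := W).inv₀ one_ne_zero
  rw [inv_one] at this
  refine this.congr' ?_
  filter_upwards [eventually_exists_some] with P hP
  obtain ⟨x, y, hxy, hy, rfl⟩ := hP
  simp only [xCoord, yCoord, zCoord_some]
  field_simp

lemma tendsto_zCoord [CharZero k] : Tendsto zCoord (atInfty W) (𝓝 0) := by
  apply tendsto_zero_of_sq
  have := tendsto_z_sq_mul_x.mul (tendsto_inv₀_cobounded.comp (tendsto_xCoord (W := W)))
  rw [mul_zero] at this
  refine this.congr' ?_
  filter_upwards [eventually_xCoord_ne] with P hP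
  simp only [Function.comp_apply]
  field_simp

lemma tendsto_inv_y : Tendsto (fun P ↦ (yCoord P)⁻¹) (atInfty W) (𝓝 0) :=
  tendsto_inv₀_cobounded.comp tendsto_yCoord

lemma eventually_zCoord_ne : ∀ᶠ P in atInfty W, zCoord P ≠ 0 := by
  filter_upwards [eventually_exists_some, eventually_xCoord_ne] with P hP hx
  obtain ⟨x, y, hxy, hy, rfl⟩ := hP
  exact div_ne_zero hx hy

/-- In the chart `[z : 1 : w]` the coordinate `w = 1 / y` vanishes to higher order than `z = x / y`
at infinity. -/
lemma tendsto_w_div_z : Tendsto (fun P ↦ (yCoord P)⁻¹ / zCoord P) (atInfty W) (𝓝 0) := by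
  refine (tendsto_inv₀_cobounded.comp (tendsto_xCoord (W := W))).congr' ?_
  filter_upwards [eventually_exists_some, eventually_xCoord_ne] with P hP hx
  obtain ⟨x, y, hxy, hy, rfl⟩ := hP
  simp only [Function.comp_apply, xCoord, yCoord, zCoord_some] at hx ⊢
  field_simp

/-- Passage from the coordinates `[x : y : 1]` to the chart `[x / y : 1 : 1 / y]`. -/
lemma eval_some_eq {d : ℕ} {p : MvPolynomial (Fin 3) k} (hp : p.IsHomogeneous d) {x y : k}
    (h : W.toAffine.Nonsingular x y) (hy : y ≠ 0) :
    MvPolynomial.eval (projCoords (Affine.Point.some x y h : W.toAffine.Point)) p =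
      y ^ d * MvPolynomial.eval ![x / y, 1, y⁻¹] p := by
  rw [← eval_smul_of_isHomogeneous hp]
  congr 2
  ext i
  fin_cases i
  · simp [projCoords]; field_simp
  · simp [projCoords]
  · simp [projCoords, hy]

variable [CharZero k]

lemma tendsto_eval_atInfty (p : MvPolynomial (Fin 3) k) :
    Tendsto (fun P ↦ MvPolynomial.eval ![zCoord P, 1, (yCoord P)⁻¹] p) (atInfty W)
      (𝓝 (MvPolynomial.eval ![0, 1, 0] p)) := by
  refine (p.continuous_eval.tendsto _).comp ?_
  rw [tendsto_pi_nhds]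
  intro i
  fin_cases i
  · exact tendsto_zCoord
  · exact tendsto_const_nhds
  · exact tendsto_inv_y

/-- The curve is tangent to the line `Z = 0` at infinity, so along it only the `X`-derivative
contributes to first order. -/
lemma tendsto_eval_sub_div (p : MvPolynomial (Fin 3) k) :
    Tendsto (fun P ↦ (MvPolynomial.eval ![zCoord P, 1, (yCoord P)⁻¹] p -
      MvPolynomial.eval ![0, 1, 0] p) / zCoord P) (atInfty W)
      (𝓝 (MvPolynomial.eval ![0, 1, 0] (MvPolynomial.pderiv 0 p))) := by
  induction p using MvPolynomial.induction_on with
  | C a => simpa using tendsto_const_nhds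
  | add p q hp hq =>
    simp only [map_add]
    refine (hp.add hq).congr fun P ↦ ?_
    ring
  | mul_X p i hp =>
    have hX : Tendsto (fun P ↦ (MvPolynomial.eval ![zCoord P, 1, (yCoord P)⁻¹] (.X i) -
        MvPolynomial.eval ![0, 1, 0] (.X i)) / zCoord P) (atInfty W)
        (𝓝 (MvPolynomial.eval ![0, 1, 0] (MvPolynomial.pderiv 0 (.X i)))) := by
      fin_cases i
      · simp only [MvPolynomial.eval_X, MvPolynomial.pderiv_X]
        refine tendsto_const_nhds.congr' ?_
        filter_upwards [eventually_zCoord_ne] with P hP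
        simp [hP]
      · simpa [MvPolynomial.pderiv_X] using tendsto_const_nhds
      · simpa [MvPolynomial.pderiv_X] using tendsto_w_div_z (W := W)
    rw [show MvPolynomial.eval ![0, 1, 0] (MvPolynomial.pderiv 0 (p * .X i)) =
        MvPolynomial.eval ![0, 1, 0] p *
          MvPolynomial.eval ![0, 1, 0] (MvPolynomial.pderiv 0 (.X i)) +
        MvPolynomial.eval ![0, 1, 0] (MvPolynomial.pderiv 0 p) *
          MvPolynomial.eval ![0, 1, 0] (.X i) by
      rw [Derivation.leibniz, map_add, smul_eq_mul, smul_eq_mul, map_mul, map_mul]; ring]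
    refine ((hX.const_mul (MvPolynomial.eval ![0, 1, 0] p)).add
      (hp.mul (tendsto_eval_atInfty (.X i)))).congr fun P ↦ ?_
    rw [map_mul, map_mul]
    ring

variable {φ ψ : W.toAffine.Point → W.toAffine.Point} {a b c : k}

/-- Near infinity, `A` computes the coordinates `[x / y : 1 : 1 / y]` of `φ P`. -/
lemma eventually_ratio_eq {d : ℕ} {A : Fin 3 → MvPolynomial (Fin 3) k}
    (hd : ∀ i, (A i).IsHomogeneous d) (h1 : MvPolynomial.eval ![0, 1, 0] (A 1) ≠ 0)
    (hA : ∀ Q : W.toAffine.Point, (∃ i, MvPolynomial.eval (projCoords Q) (A i) ≠ 0) →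
      ∃ c : k, ∀ i, MvPolynomial.eval (projCoords Q) (A i) = c * projCoords (φ Q) i) :
    ∀ᶠ P in atInfty W, MvPolynomial.eval ![zCoord P, 1, (yCoord P)⁻¹] (A 1) ≠ 0 ∧
      projCoords (φ P) 1 ≠ 0 ∧
      ∀ i, MvPolynomial.eval ![zCoord P, 1, (yCoord P)⁻¹] (A i) /
        MvPolynomial.eval ![zCoord P, 1, (yCoord P)⁻¹] (A 1) =
          projCoords (φ P) i / projCoords (φ P) 1 := by
  filter_upwards [eventually_exists_some, (tendsto_eval_atInfty (A 1)).eventually_ne h1]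
    with P hP hne
  obtain ⟨x, y, hxy, hy, rfl⟩ := hP
  simp only [zCoord_some, yCoord] at hne ⊢
  have hyd : y ^ d ≠ 0 := pow_ne_zero _ hy
  obtain ⟨c, hc⟩ := hA (.some x y hxy) ⟨1, by rw [eval_some_eq (hd 1) hxy hy]; positivity⟩
  simp only [eval_some_eq (hd _) hxy hy] at hc
  have hc1 : c * projCoords (φ (.some x y hxy)) 1 ≠ 0 := by
    rw [← hc 1]; positivity
  have h2 := right_ne_zero_of_mul hc1
  refine ⟨hne, h2, fun i ↦ ?_⟩
  rw [div_eq_div_iff hne h2]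
  apply mul_left_cancel₀ (mul_ne_zero hyd (left_ne_zero_of_mul hc1))
  linear_combination c * projCoords (φ (.some x y hxy)) 1 * hc i -
    c * projCoords (φ (.some x y hxy)) i * hc 1

/-- `φ` is continuous at infinity. Its value there is adjoined by `pure 0`, because `φ` may take
the value `0` near infinity as well. -/
lemma IsTangent.tendsto (hφ : IsTangent φ a) (h0 : φ 0 = 0) :
    Tendsto φ (atInfty W) (atInfty W ⊔ pure 0) := by
  obtain ⟨d, A, hd, h1, hA, -⟩ := hφ
  obtain ⟨c, hc⟩ := hA 0 ⟨1, h1⟩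
  have hA2 : MvPolynomial.eval ![0, 1, 0] (A 2) = 0 := by
    simpa [h0, projCoords_zero] using hc 2
  have hlim := (tendsto_eval_atInfty (W := W) (A 2)).div (tendsto_eval_atInfty (A 1)) h1
  rw [hA2, zero_div] at hlim
  rintro S ⟨⟨t, ht, htS⟩, h0S⟩
  have hev := eventually_nhdsWithin_iff.mp
    ((tendsto_inv₀_nhdsNE_zero (α := k)).eventually (eventually_mem_set.mpr ht))
  rw [mem_map]
  filter_upwards [eventually_ratio_eq hd h1 hA, hlim.eventually hev] with P hP hP'
  obtain ⟨-, h2, h3⟩ := hP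
  simp only [Pi.div_apply, h3] at hP'
  change φ P ∈ S
  generalize φ P = Q at *
  rcases Q with _ | ⟨x, y, h⟩
  · exact h0S
  · simp only [projCoords, Matrix.cons_val] at h2 hP'
    apply htS
    simpa [h2, yCoord] using hP'

/-- The first order expansion of `φ` at infinity. -/
lemma IsTangent.isLittleO (hφ : IsTangent φ a) (h0 : φ 0 = 0) :
    (fun P ↦ zCoord (φ P) - a * zCoord P) =o[atInfty W ⊔ pure 0] zCoord := by
  refine Asymptotics.IsLittleO.sup ?_ (by rw [Asymptotics.isLittleO_pure]; simp [h0])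
  obtain ⟨d, A, hd, h1, hA, ha⟩ := hφ
  obtain ⟨c, hc⟩ := hA 0 ⟨1, h1⟩
  have hA0 : MvPolynomial.eval ![0, 1, 0] (A 0) = 0 := by
    simpa [h0, projCoords_zero] using hc 0
  rw [Asymptotics.isLittleO_iff_tendsto' (by
    filter_upwards [eventually_zCoord_ne] with P hP hP' using absurd hP' hP)]
  have hlim := (tendsto_eval_sub_div (W := W) (A 0)).div (tendsto_eval_atInfty (A 1)) h1
  rw [← ha, mul_div_cancel_right₀ _ h1, hA0] at hlim
  have hlim' := hlim.sub_const a
  rw [sub_self] at hlim'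
  refine hlim'.congr' ?_
  filter_upwards [eventually_ratio_eq hd h1 hA, eventually_zCoord_ne] with P hP hz
  rw [zCoord, ← hP.2.2 0, Pi.div_apply]
  have := hP.1
  field_simp
  ring

lemma IsTangent.tendsto_div (hφ : IsTangent φ a) (h0 : φ 0 = 0) :
    Tendsto (fun P ↦ zCoord (φ P) / zCoord P) (atInfty W) (𝓝 a) := by
  have := ((hφ.isLittleO h0).mono le_sup_left).tendsto_div_nhds_zero.add_const a
  rw [zero_add] at this
  refine this.congr' ?_
  filter_upwards [eventually_zCoord_ne] with P hP
  field_simp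
  ring

lemma tendsto_neg_div : Tendsto (fun P ↦ zCoord (-P) / zCoord P) (atInfty W) (𝓝 (-1)) := by
  have h1 : Tendsto (fun P ↦ -(1 + (W.a₁ * zCoord P + W.a₃ * (yCoord P)⁻¹))⁻¹) (atInfty W)
      (𝓝 (-(1 + (W.a₁ * 0 + W.a₃ * 0))⁻¹)) :=
    (((tendsto_zCoord.const_mul _).add (tendsto_inv_y.const_mul _)).const_add 1).inv₀
      (by simp) |>.neg
  rw [mul_zero, mul_zero, add_zero, add_zero, inv_one] at h1
  refine h1.congr' ?_
  filter_upwards [eventually_exists_some, eventually_xCoord_ne] with P hP hx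
  obtain ⟨x, y, hxy, hy, rfl⟩ := hP
  simp only [zCoord_some, yCoord, xCoord, Affine.Point.neg_some, Affine.negY] at hx ⊢
  rw [show 1 + (W.a₁ * (x / y) + W.a₃ * y⁻¹) = (y + W.a₁ * x + W.a₃) / y by field_simp; ring,
    show -y - W.a₁ * x - W.a₃ = -(y + W.a₁ * x + W.a₃) by ring]
  rw [inv_div, div_neg, neg_div, div_div_eq_mul_div, div_mul_eq_mul_div, div_div,
    mul_comm x y, mul_div_mul_right _ _ hx]

/-- The `x`-coordinate of `n • P` is asymptotic to `x(P) / n ^ 2`. -/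
lemma tendsto_x_smul_div {n : ℕ} (hn : 1 ≤ n) : (∀ᶠ P in atInfty W, n • P ≠ 0) ∧
    Tendsto (fun P : W.toAffine.Point ↦ xCoord (n • P) / xCoord P) (atInfty W)
      (𝓝 ((n ^ 2 : k)⁻¹)) := by
  obtain ⟨N, D, q, d, c, h⟩ := exists_isSmulX W hn
  have hn0 : (n : k) ≠ 0 := Nat.cast_ne_zero.mpr (by omega)
  have hc := h.c_ne_zero
  have hq : ∀ᶠ P in atInfty W, q.eval (xCoord P) ≠ 0 := by
    have := isBounded_def.mp (q.finite_setOfPred_isRoot h.q_ne_zero).isBounded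
    exact tendsto_xCoord.eventually this
  have hspec : ∀ᶠ P in atInfty W, D.eval (xCoord P) ≠ 0 ∧ n • P ≠ 0 ∧
      xCoord (n • P) * D.eval (xCoord P) = N.eval (xCoord P) := by
    filter_upwards [hq, eventually_exists_some] with P hP hP'
    obtain ⟨x, y, hxy, -, rfl⟩ := hP'
    obtain ⟨hD, x', y', h', e, e'⟩ := h.spec x y hxy hP
    exact ⟨hD, by rw [e]; exact Affine.Point.some_ne_zero h', by rw [e]; exact e'⟩
  refine ⟨hspec.mono fun P hP ↦ hP.2.1, ?_⟩
  have h1 := (tendsto_eval_xCoord (W := W) h.lead_num).div (tendsto_eval_xCoord h.lead_den)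
    (by simp [hn0, hc])
  rw [show c / (n ^ 2 * c) = ((n : k) ^ 2)⁻¹ by field_simp] at h1
  refine h1.congr' ?_
  filter_upwards [hspec, eventually_xCoord_ne] with P hP hx
  obtain ⟨hD, -, e⟩ := hP
  rw [Pi.div_apply, ← e]
  field_simp
  ring

variable [IsAlgClosed k] [W.IsElliptic]

/-- Every `y` is the `y`-coordinate of a point, so infinity is not isolated. -/
instance neBot_atInfty : NeBot (atInfty W) := by
  refine NeBot.comap_of_surj inferInstance fun y ↦ ?_
  obtain ⟨x, hx⟩ := IsAlgClosed.exists_root (Polynomial.X ^ 3 + .C W.a₂ * Polynomial.X ^ 2 +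
    .C (W.a₄ - W.a₁ * y) * Polynomial.X + .C (W.a₆ - y ^ 2 - W.a₃ * y)) (by
      have : (Polynomial.X ^ 3 + .C W.a₂ * Polynomial.X ^ 2 + .C (W.a₄ - W.a₁ * y) * Polynomial.X +
        .C (W.a₆ - y ^ 2 - W.a₃ * y) : Polynomial k).degree = 3 := by compute_degree!
      rw [this]; decide)
  refine ⟨.some x y (Affine.equation_iff_nonsingular.mp ((Affine.equation_iff ..).mpr ?_)), rfl⟩
  simp only [Polynomial.IsRoot, Polynomial.eval_add, Polynomial.eval_mul, Polynomial.eval_pow,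
    Polynomial.eval_X, Polynomial.eval_C] at hx
  linear_combination -hx

lemma IsTangent.unique (hφ : IsTangent φ a) (hφ' : IsTangent φ b) (h0 : φ 0 = 0) : a = b :=
  tendsto_nhds_unique (hφ.tendsto_div h0) (hφ'.tendsto_div h0)

/-- The chain rule at infinity. -/
lemma IsTangent.comp (hφ : IsTangent φ a) (hψ : IsTangent ψ b) (h : IsTangent (φ ∘ ψ) c)
    (hφ0 : φ 0 = 0) (hψ0 : ψ 0 = 0) : c = a * b := by
  have h0 : (φ ∘ ψ) 0 = 0 := by simp [hψ0, hφ0]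
  have h1 := (hφ.isLittleO hφ0).comp_tendsto (hψ.tendsto hψ0)
  have h2 := (hψ.isLittleO hψ0).mono (le_sup_left (a := atInfty W) (b := pure 0))
  have h3 : (zCoord ∘ ψ) =O[atInfty W] zCoord := by
    have := h2.isBigO.add ((Asymptotics.isBigO_refl zCoord (atInfty W)).const_mul_left b)
    exact this.congr (fun P ↦ by simp) fun _ ↦ rfl
  have h4 :=
    ((h1.trans_isBigO h3).add (h2.const_mul_left a)).tendsto_div_nhds_zero.add_const (a * b)
  rw [zero_add] at h4
  refine tendsto_nhds_unique (h.tendsto_div h0) (h4.congr' ?_)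
  filter_upwards [eventually_zCoord_ne] with P hP
  simp only [Function.comp_apply]
  field_simp
  ring

lemma IsTangent.neg_eq (h : IsTangent (fun P : W.toAffine.Point ↦ -P) a) : a = -1 :=
  tendsto_nhds_unique (h.tendsto_div neg_zero) tendsto_neg_div

/-- The derivative of multiplication by `n` is `± n`, since `x(n • P) ∼ x(P) / n ^ 2` and
`x ∼ z ^ (-2)`. -/
lemma IsTangent.sq_of_smul {n : ℕ} (hn : 1 ≤ n)
    (h : IsTangent (fun P : W.toAffine.Point ↦ n • P) a) : a ^ 2 = n ^ 2 := by
  have hn0 : (n : k) ≠ 0 := Nat.cast_ne_zero.mpr (by omega)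
  obtain ⟨hne, hx⟩ := tendsto_x_smul_div (W := W) hn
  have h0 : (fun P : W.toAffine.Point ↦ n • P) 0 = 0 := smul_zero n
  have hinf : Tendsto (fun P : W.toAffine.Point ↦ n • P) (atInfty W) (atInfty W) := by
    refine (tendsto_inf.mpr ⟨h.tendsto h0, tendsto_principal.mpr hne⟩).mono_right
      (y := (atInfty W ⊔ pure 0) ⊓ 𝓟 {0}ᶜ) ?_
    rw [inf_sup_right, ← principal_singleton, inf_principal]
    simp
  have h1 := ((tendsto_z_sq_mul_x (W := W)).comp hinf).div tendsto_z_sq_mul_x one_ne_zero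
  have h2 := h1.mul (hx.inv₀ (by simpa using hn0))
  rw [inv_inv, one_div_one, one_mul] at h2
  refine tendsto_nhds_unique ((h.tendsto_div h0).pow 2) (h2.congr' ?_)
  filter_upwards [eventually_zCoord_ne, eventually_xCoord_ne,
    hinf.eventually eventually_xCoord_ne] with P h3 h4 h5
  simp only [Pi.div_apply, Function.comp_apply]
  field_simp

end Asymptotics

end

section

open WeierstrassCurve

/-! ### Endomorphisms fixing the torsion -/

section GroupTheory

variable {A : Type*} [AddCommGroup A] {ℓ : ℕ}

lemma endMul_apply (f g : AddMonoid.End A) (P : A) : (f * g) P = f (g P) := rfl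

/-- An endomorphism fixing the `ℓ`-torsion has an `ℓ`-power iterate fixing the
`ℓ ^ (n + 1)`-torsion. -/
lemma pow_apply_eq_of_fixes_torsion (s : AddMonoid.End A) (hs : ∀ P : A, ℓ • P = 0 → s P = P)
    (n : ℕ) (P : A) (hP : ℓ ^ (n + 1) • P = 0) : (s ^ ℓ ^ n) P = P := by
  induction n generalizing P with
  | zero => simpa using hs P (by simpa using hP)
  | succ n ih =>
    set t := s ^ ℓ ^ n with ht
    have h1 : t (ℓ • P) = ℓ • P := ih _ (by rw [smul_smul, ← pow_succ, hP])
    obtain ⟨Q, hQ⟩ : ∃ Q, t P = P + Q := ⟨t P - P, by abel⟩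
    have hQℓ : ℓ • Q = 0 := by
      rw [map_nsmul, hQ, smul_add] at h1
      simpa using h1
    have hpow : ∀ m : ℕ, (s ^ m) Q = Q := by
      intro m
      induction m with
      | zero => rfl
      | succ m ihm => rw [pow_succ, endMul_apply, hs Q hQℓ, ihm]
    have hm : ∀ m : ℕ, (t ^ m) P = P + m • Q := by
      intro m
      induction m with
      | zero => simp
      | succ m ihm =>
        rw [pow_succ', endMul_apply, ihm, map_add, map_nsmul, hpow, hQ, succ_nsmul]
        abel
    rw [pow_succ, pow_mul, hm, hQℓ, add_zero]

/-- Divisibility turns nontrivial `ℓ`-torsion into torsion of exact order `ℓ ^ (n + 1)`. -/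
lemma exists_pow_smul_eq_zero (hsurj : ∀ T : A, ∃ P : A, ℓ • P = T)
    (htor : ∃ P : A, P ≠ 0 ∧ ℓ • P = 0) (n : ℕ) : ∃ P : A, ℓ ^ n • P ≠ 0 ∧ ℓ ^ (n + 1) • P = 0 := by
  induction n with
  | zero => simpa using htor
  | succ n ih =>
    obtain ⟨P, h1, h2⟩ := ih
    obtain ⟨Q, rfl⟩ := hsurj P
    exact ⟨Q, by rwa [pow_succ, mul_smul], by rwa [pow_succ, mul_smul]⟩

/-- If `φ ∘ φ = -D`, then no endomorphism that anticommutes with `φ` can fix the `ℓ`-torsion: an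
odd power of it would fix the `ℓ ^ n`-torsion, so that `φ`, and hence `D`, would kill
the `ℓ ^ n`-torsion for all `n`. -/
lemma not_anticommute (hℓ : ℓ.Prime) (hodd : Odd ℓ) (hsurj : ∀ T : A, ∃ P : A, ℓ • P = T)
    (htor : ∃ P : A, P ≠ 0 ∧ ℓ • P = 0) {s φ : AddMonoid.End A} {D : ℕ} (hD : 1 ≤ D)
    (hs : ∀ P : A, ℓ • P = 0 → s P = P) (hφ : ∀ P, φ (φ P) = - (D • P)) :
    ¬ ∀ P, φ (s P) = - s (φ P) := by
  intro hanti
  obtain ⟨P, h1, h2⟩ := exists_pow_smul_eq_zero hsurj htor D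
  have := Fact.mk hℓ
  have hord := addOrderOf_eq_prime_pow h1 h2
  have hpow : ∀ m : ℕ, ∀ Q, φ ((s ^ m) Q) = (-1 : ℤ) ^ m • (s ^ m) (φ Q) := by
    intro m
    induction m with
    | zero => simp
    | succ m ihm =>
      intro Q
      rw [pow_succ, endMul_apply, ihm, hanti, map_neg, endMul_apply, pow_succ]
      simp
  -- `ℓ ^ D` is odd, so `φ P = -φ P`
  have h3 := hpow (ℓ ^ D) P
  rw [pow_apply_eq_of_fixes_torsion s hs D P h2, pow_apply_eq_of_fixes_torsion s hs D (φ P)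
    (by rw [← map_nsmul, h2, map_zero]), hodd.pow.neg_one_pow, neg_one_zsmul] at h3
  have h4 : 2 • φ P = 0 := by
    rw [two_smul]
    nth_rw 1 [h3]
    abel
  have h5 : ℓ ^ (D + 1) • φ P = 0 := by rw [← map_nsmul, h2, map_zero]
  have h6 : φ P = 0 := by
    have h7 := Nat.dvd_gcd (addOrderOf_dvd_of_nsmul_eq_zero h4)
      (addOrderOf_dvd_of_nsmul_eq_zero h5)
    rw [(Nat.coprime_two_left.mpr hodd.pow).gcd_eq_one, Nat.dvd_one] at h7
    exact AddMonoid.addOrderOf_eq_one_iff.mp h7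
  have h8 : D • P = 0 := by
    have := hφ P
    rw [h6, map_zero] at this
    exact neg_eq_zero.mp this.symm
  have h9 := Nat.le_of_dvd hD (hord ▸ addOrderOf_dvd_of_nsmul_eq_zero h8)
  have h10 := Nat.lt_pow_self hℓ.one_lt (n := D + 1)
  omega

end GroupTheory

/-! ### Galois conjugation of endomorphisms -/

section Galois

variable {F : Type u} [Field F] {E : WeierstrassCurve F}

variable (E) in
/-- The action of the absolute Galois group on the geometric points. -/
def galMap (σ : AlgebraicClosure F ≃ₐ[F] AlgebraicClosure F) : AddMonoid.End (GeomPoint E) :=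
  Affine.Point.map (W' := E) (S := F) (σ : AlgebraicClosure F →ₐ[F] AlgebraicClosure F)

variable (σ : AlgebraicClosure F ≃ₐ[F] AlgebraicClosure F)

lemma galMap_some {x y : AlgebraicClosure F}
    (h : (E.baseChange (AlgebraicClosure F)).toAffine.Nonsingular x y) :
    ∃ h', galMap E σ (.some x y h) = .some (σ x) (σ y) h' := ⟨_, rfl⟩

lemma projCoords_galMap (P : GeomPoint E) :
    projCoords (galMap E σ P) = σ ∘ projCoords P := by
  ext i
  rcases P with _ | ⟨x, y, h⟩
  · change projCoords (galMap E σ 0) i = _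
    rw [map_zero]
    fin_cases i <;> simp [projCoords]
  · obtain ⟨h', e⟩ := galMap_some σ h
    rw [e]
    fin_cases i <;> simp [projCoords]

lemma galMap_galMap_symm (P : GeomPoint E) : galMap E σ (galMap E σ.symm P) = P := by
  rcases P with _ | ⟨x, y, h⟩
  · change galMap E σ (galMap E σ.symm 0) = 0
    rw [map_zero, map_zero]
  · obtain ⟨h', e⟩ := galMap_some σ.symm h
    obtain ⟨h'', e'⟩ := galMap_some σ h'
    rw [e, e']
    simp

lemma galMap_symm_galMap (P : GeomPoint E) : galMap E σ.symm (galMap E σ P) = P :=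
  galMap_galMap_symm σ.symm P

/-- The conjugate `σ ∘ φ ∘ σ⁻¹` of an endomorphism by a Galois automorphism. -/
def galConj (φ : AddMonoid.End (GeomPoint E)) : AddMonoid.End (GeomPoint E) :=
  galMap E σ * φ * galMap E σ.symm

lemma galConj_apply (φ : AddMonoid.End (GeomPoint E)) (P : GeomPoint E) :
    galConj σ φ P = galMap E σ (φ (galMap E σ.symm P)) := rfl

lemma galConj_mul (φ ψ : AddMonoid.End (GeomPoint E)) :
    galConj σ (φ * ψ) = galConj σ φ * galConj σ ψ := by
  ext P
  simp only [endMul_apply, galConj_apply, galMap_symm_galMap]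

lemma eval_map_galMap (P : GeomPoint E) (p : MvPolynomial (Fin 3) (AlgebraicClosure F)) :
    MvPolynomial.eval (projCoords P) (p.map (σ : AlgebraicClosure F →+* AlgebraicClosure F)) =
      σ (MvPolynomial.eval (projCoords (galMap E σ.symm P)) p) := by
  have := MvPolynomial.map_eval (σ : AlgebraicClosure F →+* AlgebraicClosure F)
    (projCoords (galMap E σ.symm P)) p
  rw [RingHom.coe_coe, ← projCoords_galMap, galMap_galMap_symm] at this
  exact this.symm

/-- Applying `σ` to the coefficients of local equations of `φ` gives local equations of its
conjugate. -/
lemma galConj_spec {φ : AddMonoid.End (GeomPoint E)}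
    {A : Fin 3 → MvPolynomial (Fin 3) (AlgebraicClosure F)}
    (hA : ∀ Q : GeomPoint E, (∃ i, MvPolynomial.eval (projCoords Q) (A i) ≠ 0) →
      ∃ c, ∀ i, MvPolynomial.eval (projCoords Q) (A i) = c * projCoords (φ Q) i)
    (Q : GeomPoint E) (hQ : ∃ i, MvPolynomial.eval (projCoords Q)
      ((A i).map (σ : AlgebraicClosure F →+* AlgebraicClosure F)) ≠ 0) :
    ∃ c, ∀ i, MvPolynomial.eval (projCoords Q)
      ((A i).map (σ : AlgebraicClosure F →+* AlgebraicClosure F)) =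
        c * projCoords (galConj σ φ Q) i := by
  obtain ⟨i, hi⟩ := hQ
  rw [eval_map_galMap] at hi
  obtain ⟨c, hc⟩ := hA (galMap E σ.symm Q) ⟨i, fun h ↦ hi (by rw [h, map_zero])⟩
  refine ⟨σ c, fun j ↦ ?_⟩
  rw [eval_map_galMap, hc j, map_mul, galConj_apply, projCoords_galMap, Function.comp_apply]

lemma IsMorphism.galConj {φ : AddMonoid.End (GeomPoint E)}
    (hφ : IsMorphism (E.baseChange (AlgebraicClosure F)) φ) :
    IsMorphism (E.baseChange (AlgebraicClosure F)) (galConj σ φ) := by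
  intro P
  obtain ⟨d, A, hd, ⟨i, hi⟩, hA⟩ := hφ (galMap E σ.symm P)
  refine ⟨d, fun i ↦ (A i).map (σ : AlgebraicClosure F →+* AlgebraicClosure F),
    fun i ↦ (hd i).map _, ⟨i, ?_⟩, galConj_spec σ hA⟩
  rw [eval_map_galMap]
  simpa using hi

/-- Conjugation by `σ` applies `σ` to the derivative at infinity. -/
lemma IsTangent.galConj {φ : AddMonoid.End (GeomPoint E)} {a : AlgebraicClosure F}
    (hφ : IsTangent (W := E.baseChange (AlgebraicClosure F)) φ a) :
    IsTangent (W := E.baseChange (AlgebraicClosure F)) (galConj σ φ) (σ a) := by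
  obtain ⟨d, A, hd, h1, hA, ha⟩ := hφ
  have hev : ∀ p, MvPolynomial.eval ![0, 1, 0]
      (p.map (σ : AlgebraicClosure F →+* AlgebraicClosure F)) =
        σ (MvPolynomial.eval ![0, 1, 0] p) := fun p ↦ by
    simpa only [projCoords_zero, map_zero] using eval_map_galMap σ (0 : GeomPoint E) p
  refine ⟨d, fun i ↦ (A i).map (σ : AlgebraicClosure F →+* AlgebraicClosure F),
    fun i ↦ (hd i).map _, ?_, galConj_spec σ hA, ?_⟩
  · rw [hev]
    simpa using h1
  · rw [hev, MvPolynomial.pderiv_map, hev, ← map_mul, ha]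

lemma galMap_eq_self_of_mem_fixingSubgroup {n : ℕ} (hσ : σ ∈ (torsionField E n).fixingSubgroup)
    (P : GeomPoint E) (hP : n • P = 0) : galMap E σ P = P := by
  rcases P with _ | ⟨x, y, h⟩
  · exact map_zero (galMap E σ)
  · have hmem : ∀ z, z = x ∨ z = y → σ z = z := fun z hz ↦
      (IntermediateField.mem_fixingSubgroup_iff _ _).mp hσ z
        (IntermediateField.subset_adjoin _ _ ⟨x, y, h, hP, hz⟩)
    obtain ⟨h', e⟩ := galMap_some σ h
    rw [e]
    simp only [hmem x (Or.inl rfl), hmem y (Or.inr rfl)]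

end Galois

end

section

open WeierstrassCurve

/-! ### Square roots in the torsion field -/

/-- The absolute value of `ℂ`, restricted along an embedding. The field structure underlying the
norm is the given one, so that `subst` can replace the latter by the former. -/
lemma exists_nontriviallyNormedField {k : Type u} [fk : Field k] (e : k →+* ℂ) :
    ∃ i : NontriviallyNormedField k, i.toNormedField.toField = fk :=
  ⟨{ NormedField.induced k ℂ e e.injective with
      non_trivial := ⟨2, show 1 < ‖e 2‖ by rw [map_ofNat]; simp⟩ }, rfl⟩

section Embedding

/-! The conclusions below do not mention the norm that their proofs use. -/

variable {k : Type u} [fk : Field k] [IsAlgClosed k] [CharZero k]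
  {W : WeierstrassCurve k} [W.IsElliptic]
  {φ ψ : W.toAffine.Point → W.toAffine.Point} {a b c : k}

lemma tangent_unique (e : k →+* ℂ) (hφ : IsTangent φ a) (hφ' : IsTangent φ b) (h0 : φ 0 = 0) :
    a = b := by
  obtain ⟨i, h⟩ := exists_nontriviallyNormedField e
  subst h
  exact hφ.unique hφ' h0

lemma tangent_comp (e : k →+* ℂ) (hφ : IsTangent φ a) (hψ : IsTangent ψ b)
    (h : IsTangent (φ ∘ ψ) c) (hφ0 : φ 0 = 0) (hψ0 : ψ 0 = 0) : c = a * b := by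
  obtain ⟨i, hi⟩ := exists_nontriviallyNormedField e
  subst hi
  exact hφ.comp hψ h hφ0 hψ0

lemma tangent_neg (e : k →+* ℂ) (h : IsTangent (fun P : W.toAffine.Point ↦ -P) a) : a = -1 := by
  obtain ⟨i, hi⟩ := exists_nontriviallyNormedField e
  subst hi
  exact h.neg_eq

lemma tangent_smul_sq (e : k →+* ℂ) {n : ℕ} (hn : 1 ≤ n)
    (h : IsTangent (fun P : W.toAffine.Point ↦ n • P) a) : a ^ 2 = n ^ 2 := by
  obtain ⟨i, hi⟩ := exists_nontriviallyNormedField e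
  subst hi
  exact h.sq_of_smul hn

lemma exists_torsion_of_isMorphism (e : k →+* ℂ) {n : ℕ} (hodd : Odd n) (hn : 1 < n)
    (hmor : IsMorphism W fun P ↦ n • P) :
    ∃ P : W.toAffine.Point, P ≠ 0 ∧ n • P = 0 := by
  obtain ⟨i, hi⟩ := exists_nontriviallyNormedField e
  subst hi
  exact exists_torsion hodd hn hmor

end Embedding

section Package

variable {F : Type u} [Field F] [NumberField F] (E : WeierstrassCurve F) [E.IsElliptic]
  {O : Type v} [CommRing O] [IsDomain O]

lemma nonempty_algebraicClosure_embedding : Nonempty (AlgebraicClosure F →+* ℂ) := by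
  obtain ⟨f⟩ : Nonempty (F →+* ℂ) := inferInstance
  let := f.toAlgebra
  exact ⟨(IsAlgClosed.lift : AlgebraicClosure F →ₐ[F] ℂ)⟩

/-- The derivative at infinity of a square root `ψ` of `-D` in the endomorphism ring is a square
root of `± D`, and of `-D` if `D` is a square. It lies in the field generated by the `ℓ`-torsion,
because an automorphism fixing that field must commute with `ψ`. -/
theorem exists_sqrt_mem_torsionField (ι : O →+* AddMonoid.End (GeomPoint E))
    (hinj : Function.Injective ι)
    (hrange : ∀ φ : AddMonoid.End (GeomPoint E),
      (∃ a, ι a = φ) ↔ IsMorphism (E.baseChange (AlgebraicClosure F)) φ)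
    {ψ : O} {D : ℕ} (hD : 1 ≤ D) (hψ : ψ * ψ = - (D : O)) {ℓ : ℕ} (hℓ : ℓ.Prime) (hodd : Odd ℓ) :
    ∃ r ∈ torsionField E ℓ, (r ^ 2 = D ∨ r ^ 2 = - D) ∧ ∀ m : ℕ, D = m ^ 2 → r ^ 2 = - D := by
  obtain ⟨e⟩ := nonempty_algebraicClosure_embedding (F := F)
  let W := E.baseChange (AlgebraicClosure F)
  have hWell : W.IsElliptic := inferInstanceAs (E.map _).IsElliptic
  have hmor : ∀ a, IsMorphism W (ι a) := fun a ↦ (hrange _).mp ⟨a, rfl⟩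
  have htan : ∀ a, ∃ t, IsTangent (W := W) (ι a) t := fun a ↦
    (hmor a).exists_isTangent (map_zero (ι a))
  choose t ht using htan
  have hnat : ∀ n : ℕ, ⇑(ι n) = fun P ↦ n • P := fun n ↦ by
    rw [map_natCast]; rfl
  have hmul : ∀ a b, t (a * b) = t a * t b := fun a b ↦
    tangent_comp e (ht a) (ht b) (by have := ht (a * b); rwa [map_mul] at this) (map_zero _)
      (map_zero _)
  have hsq : ∀ n : ℕ, 1 ≤ n → t n ^ 2 = (n : AlgebraicClosure F) ^ 2 := fun n hn ↦
    tangent_smul_sq (W := W) e hn (by simpa only [hnat] using ht n)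
  have hneg : t (-1) = -1 := by
    have := ht (-1)
    rw [map_neg, map_one] at this
    exact tangent_neg (W := W) e this
  refine ⟨t ψ, ?_, ?_, ?_⟩
  · rw [← InfiniteGalois.fixedField_fixingSubgroup (torsionField E ℓ)]
    rintro ⟨σ, hσ⟩
    change σ (t ψ) = t ψ
    -- the conjugate of `ψ` by `σ` is again a square root of `-D`, so it is `ψ` or `-ψ`
    obtain ⟨b, hb⟩ := (hrange _).mpr ((hmor ψ).galConj σ)
    have hbb : b * b = ψ * ψ := by
      apply hinj
      rw [map_mul, hb, ← galConj_mul, ← map_mul, hψ, map_neg, map_natCast]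
      ext P
      change galMap E σ (-(D • galMap E σ.symm P)) = -(D • P)
      rw [map_neg, map_nsmul, galMap_galMap_symm]
    rcases mul_self_eq_mul_self_iff.mp hbb with rfl | rfl
    · refine tangent_unique (W := W) e ((ht b).galConj σ) ?_ (map_zero _)
      rw [← hb]
      exact ht b
    · exfalso
      refine not_anticommute hℓ hodd (smul_surjective (W := W) hℓ.one_le)
        (exists_torsion_of_isMorphism (W := W) e hodd hℓ.one_lt (by simpa only [hnat] using hmor ℓ))
        (s := galMap E σ) (φ := ι ψ) hD
        (galMap_eq_self_of_mem_fixingSubgroup σ hσ) (fun P ↦ ?_) (fun P ↦ ?_)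
      · rw [← endMul_apply, ← map_mul, hψ, map_neg, map_natCast]
        rfl
      · have := DFunLike.congr_fun hb (galMap E σ P)
        rw [galConj_apply, galMap_symm_galMap, map_neg] at this
        exact neg_eq_iff_eq_neg.mp this
  · rw [← sq_eq_sq_iff_eq_or_eq_neg, sq (t ψ), ← hmul, hψ, ← neg_one_mul, hmul, hneg, mul_pow,
      hsq D hD]
    ring
  · rintro m rfl
    have hm : 1 ≤ m := by
      by_contra! h0
      obtain rfl : m = 0 := by omega
      simp at hD
    rw [sq (t ψ), ← hmul, hψ, ← neg_one_mul, hmul, hneg, Nat.cast_pow, sq (m : O), hmul, ← sq,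
      hsq m hm]
    push_cast
    ring

end Package

end

/-! ### Extensions of odd degree -/

section OddDegree

/-- An extension of odd degree contains no new square roots. -/
lemma exists_algebraMap_eq_of_sq {K L : Type*} [Field K] [Field L] [Algebra K L]
    (hodd : Odd (Module.finrank K L)) {x : L} {c : K} (hx : x ^ 2 = algebraMap K L c) :
    ∃ y, algebraMap K L y = x := by
  by_cases h : ∃ b : K, b ^ 2 = c
  · obtain ⟨b, rfl⟩ := h
    rw [map_pow, sq_eq_sq_iff_eq_or_eq_neg] at hx
    rcases hx with hx | hx
    · exact ⟨b, hx.symm⟩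
    · exact ⟨-b, by rw [map_neg, hx]⟩
  · push Not at h
    exfalso
    have hroot : Polynomial.aeval x (Polynomial.X ^ 2 - Polynomial.C c) = 0 := by simp [hx]
    have hmin := minpoly.eq_of_irreducible_of_monic
      (X_pow_sub_C_irreducible_of_prime Nat.prime_two h) hroot
      (Polynomial.monic_X_pow_sub_C c two_ne_zero)
    have hdvd := minpoly.degree_dvd (K := K) (x := x)
      ⟨_, Polynomial.monic_X_pow_sub_C c two_ne_zero, hroot⟩
    rw [← hmin, Polynomial.natDegree_X_pow_sub_C] at hdvd
    exact (Nat.not_even_iff_odd.mpr hodd) (even_iff_two_dvd.mpr hdvd)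

lemma mem_of_sq_mem_of_odd_relfinrank {F L : Type*} [Field F] [Field L] [Algebra F L]
    {A B : IntermediateField F L} (hodd : Odd (A.relfinrank B)) {x : L} (hx : x ∈ B)
    (hx2 : x ^ 2 ∈ A) : x ∈ A := by
  rw [← IntermediateField.inf_relfinrank_right,
    IntermediateField.relfinrank_eq_finrank_of_le inf_le_right] at hodd
  obtain ⟨y, hy⟩ := exists_algebraMap_eq_of_sq hodd
    (x := (⟨x, hx⟩ : IntermediateField.extendScalars (inf_le_right : A ⊓ B ≤ B)))
    (c := ⟨x ^ 2, hx2, pow_mem hx 2⟩) rfl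
  have : (y : L) = x := congrArg Subtype.val hy
  exact this ▸ y.2.1

/-- In an odd degree extension of `ℚ`, only the squares of rational numbers among the
rational numbers are squares. -/
lemma exists_rat_sq_eq {F : Type*} [Field F] [NumberField F] (hF : Odd (Module.finrank ℚ F))
    {f : F} {c : ℚ} (h : f ^ 2 = (c : F)) : ∃ q : ℚ, q ^ 2 = c := by
  obtain ⟨q, rfl⟩ := exists_algebraMap_eq_of_sq hF (x := f) (c := c) (by simpa using h)
  refine ⟨q, (algebraMap ℚ F).injective ?_⟩
  simpa using h

end OddDegree

/-! ### Square roots in the cyclotomic extension -/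

section Cyclotomic

variable {F : Type u} [Field F] [CharZero F] {ℓ : ℕ}

lemma exists_isPrimitiveRoot_algebraicClosure (hℓ : ℓ.Prime) :
    ∃ ζ : AlgebraicClosure F, IsPrimitiveRoot ζ ℓ := by
  have : NeZero ((ℓ : ℕ) : AlgebraicClosure F) := ⟨Nat.cast_ne_zero.mpr hℓ.ne_zero⟩
  exact HasEnoughRootsOfUnity.exists_primitiveRoot _ _

/-- The quadratic Gauss sum: the `ℓ`-th cyclotomic field contains a square root of `± ℓ`. -/
lemma exists_sq_eq_mem_rootsOfUnityField (hℓ : ℓ.Prime) (hodd : Odd ℓ) :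
    ∃ g ∈ rootsOfUnityField F ℓ, g ^ 2 = (ℓ : AlgebraicClosure F) ∨ g ^ 2 = -ℓ := by
  obtain ⟨ζ, hζ⟩ := exists_isPrimitiveRoot_algebraicClosure (F := F) hℓ
  have := Fact.mk hℓ
  set χ : MulChar (ZMod ℓ) (AlgebraicClosure F) :=
    (quadraticChar (ZMod ℓ)).ringHomComp (Int.castRingHom _)
  have hχ : χ ≠ 1 := (MulChar.ringHomComp_ne_one_iff (RingHom.injective_int _)).mpr
    (quadraticChar_ne_one (by
      rw [ZMod.ringChar_zmod_n]
      rintro rfl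
      exact absurd hodd (by decide)))
  have hχ2 : χ.IsQuadratic := (quadraticChar_isQuadratic (ZMod ℓ)).comp _
  clear_value χ
  have hsq := gaussSum_sq hχ hχ2 (AddChar.zmodChar_primitive_of_primitive_root ℓ hζ)
  refine ⟨gaussSum χ (AddChar.zmodChar ℓ hζ.pow_eq_one), ?_, ?_⟩
  · have hζmem : ζ ∈ rootsOfUnityField F ℓ := IntermediateField.subset_adjoin F _ hζ.pow_eq_one
    rw [gaussSum]
    refine sum_mem fun a _ ↦ mul_mem ?_ ?_
    · rcases hχ2 a with h | h | h <;> rw [h]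
      · exact zero_mem _
      · exact one_mem _
      · exact neg_mem (one_mem _)
    · rw [AddChar.zmodChar_apply]
      exact pow_mem hζmem _
  · rw [ZMod.card] at hsq
    rcases hχ2 (-1) with h | h | h
    · exact absurd h (isUnit_one.neg.map χ).ne_zero
    · left; rw [hsq, h, one_mul]
    · right; rw [hsq, h, neg_one_mul]

/-- The extension `F(μ_ℓ) / F` is cyclic: an element of `F(μ_ℓ)` is in `F` as soon as it is fixed
by one automorphism, chosen to generate the Galois group. -/
lemma exists_generator (F : Type u) [Field F] [CharZero F] (hℓ : ℓ.Prime) :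
    ∃ σ : AlgebraicClosure F ≃ₐ[F] AlgebraicClosure F, ∀ x ∈ rootsOfUnityField F ℓ, σ x = x →
      x ∈ (⊥ : IntermediateField F (AlgebraicClosure F)) := by
  obtain ⟨ζ, hζ⟩ := exists_isPrimitiveRoot_algebraicClosure (F := F) hℓ
  have := Fact.mk hℓ
  set χ := hζ.autToPow F with hχ
  obtain ⟨⟨_, σ, rfl⟩, hσ⟩ := IsCyclic.exists_generator (α := χ.range)
  refine ⟨σ, fun x hx hfix ↦ (InfiniteGalois.mem_bot_iff_fixed x).mpr fun τ ↦ ?_⟩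
  obtain ⟨j, hj⟩ := Subgroup.mem_zpowers_iff.mp (hσ ⟨χ τ, τ, rfl⟩)
  have hj' : χ (σ ^ j) = χ τ := by
    rw [map_zpow]
    exact congrArg Subtype.val hj
  set ρ := (σ ^ j)⁻¹ * τ with hρ
  have hρ1 : χ ρ = 1 := by rw [hρ, map_mul, map_inv, hj', inv_mul_cancel]
  have hρζ : ρ ζ = ζ := by
    rw [← hζ.autToPow_spec F ρ, ← hχ, hρ1, Units.val_one, ZMod.val_one, pow_one]
  have hle : rootsOfUnityField F ℓ ≤ IntermediateField.fixedField (Subgroup.zpowers ρ) := by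
    refine IntermediateField.adjoin_le_iff.mpr fun z hz ↦ ?_
    obtain ⟨i, -, rfl⟩ := hζ.eq_pow_of_pow_eq_one hz
    rw [SetLike.mem_coe, IntermediateField.mem_fixedField_iff]
    have : ρ ∈ MulAction.stabilizer _ (ζ ^ i) := by
      rw [MulAction.mem_stabilizer_iff, AlgEquiv.smul_def, map_pow, hρζ]
    intro f hf
    exact (Subgroup.zpowers_le.mpr this) hf
  have h1 : ρ x = x := IntermediateField.mem_fixedField_iff _ _ |>.mp (hle hx) ρ
    (Subgroup.mem_zpowers ρ)
  have h2 : (σ ^ j) x = x := by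
    have : σ ∈ MulAction.stabilizer _ x := hfix
    exact (Subgroup.zpowers_le.mpr this) ⟨j, rfl⟩
  have h3 : τ = σ ^ j * ρ := by rw [hρ, mul_inv_cancel_left]
  rw [h3, AlgEquiv.mul_apply, h1, h2]

/-- Two square roots `r`, `g` of elements of `F` in the cyclic extension `F(μ_ℓ) / F` generate the
same extension of `F`, if neither is in `F`. -/
lemma mem_bot_or_mul_mem_bot (hℓ : ℓ.Prime) {r g : AlgebraicClosure F}
    (hr : r ∈ rootsOfUnityField F ℓ) (hg : g ∈ rootsOfUnityField F ℓ)
    (hr2 : r ^ 2 ∈ (⊥ : IntermediateField F (AlgebraicClosure F)))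
    (hg2 : g ^ 2 ∈ (⊥ : IntermediateField F (AlgebraicClosure F))) :
    r ∈ (⊥ : IntermediateField F (AlgebraicClosure F)) ∨
    g ∈ (⊥ : IntermediateField F (AlgebraicClosure F)) ∨
    r * g ∈ (⊥ : IntermediateField F (AlgebraicClosure F)) := by
  obtain ⟨σ, hσ⟩ := exists_generator F hℓ
  have key : ∀ x : AlgebraicClosure F, x ^ 2 ∈ (⊥ : IntermediateField F (AlgebraicClosure F)) →
      σ x = x ∨ σ x = -x := by
    intro x hx
    obtain ⟨f, hf⟩ := IntermediateField.mem_bot.mp hx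
    rw [← sq_eq_sq_iff_eq_or_eq_neg, ← map_pow, ← hf, AlgEquiv.commutes]
  rcases key r hr2 with h1 | h1
  · exact Or.inl (hσ r hr h1)
  rcases key g hg2 with h2 | h2
  · exact Or.inr (Or.inl (hσ g hg h2))
  · exact Or.inr (Or.inr (hσ _ (mul_mem hr hg) (by rw [map_mul, h1, h2, neg_mul_neg])))

end Cyclotomic

/-! ### Imaginary quadratic fields -/

section ImaginaryQuadratic

variable {K : Type v} [Field K] [NumberField K]

lemma exists_basis_of_not_rational (hK : Module.finrank ℚ K = 2) {x : K}
    (hx : x ∉ (algebraMap ℚ K).range) :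
    ∃ b : Module.Basis (Fin 2) ℚ K, b 0 = 1 ∧ b 1 = x := by
  have hli : LinearIndependent ℚ ![1, x] := by
    rw [LinearIndependent.pair_iff]
    intro s t h
    have ht : t = 0 := by
      by_contra ht
      refine hx ⟨-s / t, ?_⟩
      have ht' : algebraMap ℚ K t ≠ 0 := by simpa using ht
      rw [Algebra.smul_def, Algebra.smul_def, mul_one] at h
      rw [map_div₀, map_neg, div_eq_iff ht']
      linear_combination -h
    subst ht
    simpa using h
  refine ⟨basisOfLinearIndependentOfCardEqFinrank hli (by simp [hK]), ?_, ?_⟩ <;> simp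

lemma not_mem_range_of_sq_neg {x : K} {c : ℚ} (hc : c < 0) (hx : x ^ 2 = (c : K)) :
    x ∉ (algebraMap ℚ K).range := by
  rintro ⟨q, rfl⟩
  have : q ^ 2 = c := (algebraMap ℚ K).injective (by simpa using hx)
  nlinarith [sq_nonneg q]

lemma trace_eq_zero_of_sq_neg (hK : Module.finrank ℚ K = 2) {x : K} {c : ℚ}
    (hc : c < 0) (hx : x ^ 2 = (c : K)) :
    Algebra.trace ℚ K x = 0 := by
  obtain ⟨b, h0, h1⟩ := exists_basis_of_not_rational hK (not_mem_range_of_sq_neg hc hx)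
  have e0 : x * b 0 = b 1 := by rw [h0, h1, mul_one]
  have e1 : x * b 1 = c • b 0 := by rw [h0, h1, ← sq, hx, Rat.smul_def, mul_one]
  rw [Algebra.trace_eq_matrix_trace b, Matrix.trace_fin_two, Algebra.leftMulMatrix_eq_repr_mul,
    Algebra.leftMulMatrix_eq_repr_mul, e0, e1, map_smul, b.repr_self, b.repr_self]
  simp

/-- A prime `ℓ ≠ 2` divides the discriminant of `ℚ(√-ℓ)`: the discriminant of `1, √-ℓ` is `-4 ℓ`,
and it is the product of the field discriminant and a square. -/
lemma dvd_discr_of_sq_eq_neg (hK : Module.finrank ℚ K = 2) {ℓ : ℕ} (hℓ : ℓ.Prime)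
    (hodd : Odd ℓ) {x : K}
    (hx : x ^ 2 = -(ℓ : K)) : (ℓ : ℤ) ∣ NumberField.discr K := by
  have hxint : IsIntegral ℤ x := by
    refine IsIntegral.of_pow two_pos ?_
    rw [hx]
    have : IsIntegral ℤ (ℓ : K) := by
      simpa using isIntegral_algebraMap (R := ℤ) (A := K) (x := (ℓ : ℤ))
    exact this.neg
  set y : NumberField.RingOfIntegers K := ⟨x, hxint⟩
  have hy : y * y = ((-ℓ : ℤ) : NumberField.RingOfIntegers K) := by
    apply NumberField.RingOfIntegers.coe_injective
    rw [map_mul, map_intCast]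
    push_cast
    rw [← hx, sq]
    rfl
  have htr : Algebra.trace ℤ (NumberField.RingOfIntegers K) y = 0 := by
    have hc : (-ℓ : ℚ) < 0 := by simpa using hℓ.pos
    have := trace_eq_zero_of_sq_neg hK hc (x := x) (by rw [hx]; push_cast; rfl)
    exact_mod_cast (Algebra.coe_trace_int y).trans this
  have hrank : Module.finrank ℤ (NumberField.RingOfIntegers K) = 2 := by
    rw [NumberField.RingOfIntegers.rank, hK]
  have htrn : ∀ n : ℤ, Algebra.trace ℤ (NumberField.RingOfIntegers K)
      (n : NumberField.RingOfIntegers K) = 2 * n := by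
    intro n
    have := Algebra.trace_algebraMap (R := ℤ) (S := NumberField.RingOfIntegers K) n
    rw [hrank] at this
    simpa using this
  set b := Module.finBasisOfFinrankEq ℤ (NumberField.RingOfIntegers K) hrank
  have hdisc := Algebra.discr_of_matrix_vecMul (A := ℤ) b (b.toMatrix ![1, y])
  rw [Module.Basis.toMatrix_map_vecMul, NumberField.discr_eq_discr, Algebra.discr_def,
    Matrix.det_fin_two] at hdisc
  simp only [Algebra.traceMatrix_apply, Algebra.traceForm_apply, Matrix.cons_val_zero,
    Matrix.cons_val_one, mul_one, one_mul, htr, hy, htrn] at hdisc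
  have htr1 : Algebra.trace ℤ (NumberField.RingOfIntegers K) 1 = 2 := by simpa using htrn 1
  rw [htr1] at hdisc
  set d := (b.toMatrix ![1, y]).det
  have hp : Prime (ℓ : ℤ) := Nat.prime_iff_prime_int.mp hℓ
  -- `hdisc` now reads `-4 ℓ = d ^ 2 * discr K`
  have hdvd : (ℓ : ℤ) ∣ d ^ 2 * NumberField.discr K := ⟨-4, by rw [← hdisc]; ring⟩
  rcases hp.dvd_or_dvd hdvd with h | h
  · exfalso
    obtain ⟨e, he⟩ := hp.dvd_of_dvd_pow h
    rw [he] at hdisc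
    have h4 : (ℓ : ℤ) ∣ 2 ^ 2 := by
      refine ⟨-(e ^ 2 * NumberField.discr K), mul_left_cancel₀ hp.ne_zero ?_⟩
      linear_combination -hdisc
    have h2 := (Nat.prime_dvd_prime_iff_eq hℓ Nat.prime_two).mp
      (by exact_mod_cast hp.dvd_of_dvd_pow h4)
    rw [h2] at hodd
    exact absurd hodd (by decide)
  · exact h

/-- An order in an imaginary quadratic field contains a square root of a negative integer. -/
lemma exists_sq_eq_neg_mem_order (hK : Module.finrank ℚ K = 2)
    (hKim : NumberField.IsTotallyComplex K) {O : Subring K}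
    (hO : IsOrder O) : ∃ ψ : O, ∃ D : ℕ, 1 ≤ D ∧ ψ * ψ = -(D : O) := by
  obtain ⟨hfin, hspan⟩ := hO
  obtain ⟨θ, hθO, hθ⟩ : ∃ θ ∈ O, θ ∉ (algebraMap ℚ K).range := by
    by_contra! hcon
    have hle : (⊤ : Submodule ℚ K) ≤ ℚ ∙ (1 : K) := by
      rw [← hspan, Submodule.span_le]
      intro z hz
      obtain ⟨q, rfl⟩ := hcon z hz
      exact Submodule.mem_span_singleton.mpr ⟨q, by rw [Algebra.smul_def, mul_one]⟩
    have := (Submodule.finrank_mono hle).trans (finrank_span_singleton (K := ℚ) one_ne_zero).le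
    rw [finrank_top, hK] at this
    omega
  have hint : IsIntegral ℤ θ :=
    (Algebra.IsIntegral.isIntegral (R := ℤ) (⟨θ, hθO⟩ : O)).map O.subtype.toIntAlgHom
  have hdeg : (minpoly ℤ θ).natDegree = 2 := by
    have h1 := minpoly.natDegree_le (A := ℚ) θ
    have h2 := (minpoly.two_le_natDegree_iff (A := ℚ) hint.tower_top).mpr hθ
    rw [minpoly.isIntegrallyClosed_eq_field_fractions' ℚ hint,
      (minpoly.monic hint).natDegree_map] at h1 h2
    omega
  have hroot := minpoly.aeval ℤ θ
  have hlead : (minpoly ℤ θ).coeff 2 = 1 := hdeg ▸ (minpoly.monic hint).coeff_natDegree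
  rw [Polynomial.aeval_eq_sum_range, hdeg] at hroot
  simp only [Finset.sum_range_succ, Finset.sum_range_zero, hlead] at hroot
  set c₀ := (minpoly ℤ θ).coeff 0
  set c₁ := (minpoly ℤ θ).coeff 1
  simp only [zsmul_eq_mul, pow_zero, pow_one, zero_add, mul_one, Int.cast_one, one_mul] at hroot
  -- completing the square: `x ^ 2` is the discriminant of the minimal polynomial of `θ`
  set x : K := 2 * θ + c₁ with hx
  have hxO : x ∈ O := add_mem (mul_mem (ofNat_mem O 2) hθO) (intCast_mem O c₁)
  have hx2 : x * x = ((c₁ ^ 2 - 4 * c₀ : ℤ) : K) := by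
    push_cast
    rw [hx]
    linear_combination 4 * hroot
  set Δ := c₁ ^ 2 - 4 * c₀
  have hxQ : x ∉ (algebraMap ℚ K).range := by
    rintro ⟨q, hq⟩
    refine hθ ⟨(q - c₁) / 2, ?_⟩
    rw [map_div₀, map_sub, hq, hx]
    simp
  -- otherwise `K` would embed into `ℝ`
  have hΔ : Δ < 0 := by
    by_contra! hΔ
    obtain ⟨φ⟩ : Nonempty (K →+* ℂ) := inferInstance
    have hreal : NumberField.ComplexEmbedding.IsReal φ := by
      obtain ⟨b, h0, h1⟩ := exists_basis_of_not_rational hK hxQ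
      have hφx : (starRingEnd ℂ) (φ x) = φ x := by
        have h2 : φ x ^ 2 = ((√(Δ : ℝ) : ℝ) : ℂ) ^ 2 := by
          rw [← Complex.ofReal_pow, Real.sq_sqrt (by exact_mod_cast hΔ), sq, ← map_mul, hx2]
          simp
        rcases sq_eq_sq_iff_eq_or_eq_neg.mp h2 with h | h
        · rw [h, Complex.conj_ofReal]
        · rw [h, map_neg, Complex.conj_ofReal]
      rw [NumberField.ComplexEmbedding.isReal_iff]
      ext z
      rw [NumberField.ComplexEmbedding.conjugate_coe_eq, ← b.sum_repr z, Fin.sum_univ_two, h0, h1]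
      simp [Rat.smul_def, hφx]
    have hc := hKim.isComplex (NumberField.InfinitePlace.mk φ)
    exact NumberField.InfinitePlace.not_isReal_iff_isComplex.mpr hc ⟨φ, hreal, rfl⟩
  obtain ⟨D, hD⟩ : ∃ D : ℕ, Δ = -(D : ℤ) := ⟨Δ.natAbs, by omega⟩
  refine ⟨⟨x, hxO⟩, D, by omega, Subtype.ext ?_⟩
  change x * x = _
  rw [hx2, hD]
  push_cast
  rfl

end ImaginaryQuadratic

end EllipticCM

end

theorem mainTheorem5 {F : Type*} [Field F] [NumberField F] (hF : Odd (Module.finrank ℚ F))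
    {K : Type*} [Field K] [NumberField K] (hK : Module.finrank ℚ K = 2)
    (hKim : NumberField.IsTotallyComplex K)
    (E : WeierstrassCurve F) [E.IsElliptic] (hE : EllipticCM.HasCMByOrderIn E K)
    (ℓ : ℕ) (hℓ : ℓ.Prime) (hℓodd : Odd ℓ)
    (hdeg : ∃ k : ℕ, (EllipticCM.rootsOfUnityField F ℓ).relfinrank
      (EllipticCM.torsionField E ℓ) = ℓ ^ k) :
    (ℓ : ℤ) ∣ NumberField.discr K := by
  obtain ⟨O, hO, ι, hinj, hrange⟩ := hE
  obtain ⟨ψ, D, hD, hψ⟩ := EllipticCM.exists_sq_eq_neg_mem_order hK hKim hO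
  obtain ⟨r, hr, hr2, hrD⟩ :=
    EllipticCM.exists_sqrt_mem_torsionField E ι hinj hrange hD hψ hℓ hℓodd
  obtain ⟨g, hg, hg2⟩ := EllipticCM.exists_sq_eq_mem_rootsOfUnityField (F := F) hℓ hℓodd
  -- `r` has degree at most two over `F(μ_ℓ)`, while the degree of `F(E[ℓ])` over it is odd
  have hodd : Odd ((EllipticCM.rootsOfUnityField F ℓ).relfinrank
      (EllipticCM.torsionField E ℓ)) := by
    obtain ⟨k, hk⟩ := hdeg
    exact hk ▸ hℓodd.pow
  have hr' : r ∈ EllipticCM.rootsOfUnityField F ℓ := by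
    refine EllipticCM.mem_of_sq_mem_of_odd_relfinrank hodd hr ?_
    rcases hr2 with h | h <;> rw [h]
    · exact natCast_mem _ D
    · exact neg_mem (natCast_mem _ D)
  have hbot : ∀ {x : AlgebraicClosure F} {n : ℕ}, x ^ 2 = n ∨ x ^ 2 = -n →
      x ^ 2 ∈ (⊥ : IntermediateField F (AlgebraicClosure F)) := by
    rintro x n (h | h) <;> rw [h]
    · exact natCast_mem _ n
    · exact neg_mem (natCast_mem _ n)
  -- an element of `F` whose square is `± n` forces `n` to be the square of a rational number
  have hsq : ∀ {x : AlgebraicClosure F} {n : ℕ}, 1 ≤ n → x ^ 2 = n ∨ x ^ 2 = -n →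
      x ∈ (⊥ : IntermediateField F (AlgebraicClosure F)) → x ^ 2 = n ∧ ∃ q : ℚ, q ^ 2 = n := by
    rintro x n hn h hx
    obtain ⟨f, rfl⟩ := IntermediateField.mem_bot.mp hx
    rcases h with h | h
    · have hf : f ^ 2 = ((n : ℚ) : F) := by
        apply (algebraMap F (AlgebraicClosure F)).injective
        simpa using h
      exact ⟨h, EllipticCM.exists_rat_sq_eq hF hf⟩
    · have hf : f ^ 2 = ((-n : ℚ) : F) := by
        apply (algebraMap F (AlgebraicClosure F)).injective
        simpa using h
      obtain ⟨q, hq⟩ := EllipticCM.exists_rat_sq_eq hF hf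
      have : (0 : ℚ) < n := by exact_mod_cast hn
      nlinarith [sq_nonneg q]
  have hnat : ∀ {n : ℕ} {q : ℚ}, q ^ 2 = n → IsSquare n := fun {n q} h ↦
    Rat.isSquare_natCast_iff.mp ⟨q, by rw [← h, sq]⟩
  -- the cases `r ∈ F` and `g ∈ F` are impossible
  rcases EllipticCM.mem_bot_or_mul_mem_bot hℓ hr' hg (hbot hr2) (hbot hg2) with h | h | h
  · exfalso
    obtain ⟨h1, q, hq⟩ := hsq hD hr2 h
    obtain ⟨m, hm⟩ := hnat hq
    have h2 := hrD m (by rw [hm, sq])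
    rw [h1] at h2
    have h3 : (D : AlgebraicClosure F) = 0 := self_eq_neg.mp h2
    have h4 : D = 0 := by exact_mod_cast h3
    omega
  · exfalso
    obtain ⟨-, q, hq⟩ := hsq hℓ.one_le hg2 h
    exact hℓ.prime.irreducible.not_isSquare (hnat hq)
  · obtain ⟨-, q, hq⟩ := hsq (n := D * ℓ) (Nat.mul_pos hD hℓ.pos) (x := r * g) (by
      rw [mul_pow]
      push_cast
      rcases hr2 with h1 | h1 <;> rcases hg2 with h2 | h2 <;> rw [h1, h2] <;> simp) h
    -- `D * ℓ = q ^ 2`, so `ψ * q / D` is a square root of `-ℓ` in `K`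
    have hD0 : (D : K) ≠ 0 := Nat.cast_ne_zero.mpr (by omega)
    refine EllipticCM.dvd_discr_of_sq_eq_neg hK hℓ hℓodd (x := (ψ : K) * q / D) ?_
    have hψ' : (ψ : K) * ψ = -D := by
      have := congrArg O.subtype hψ
      simpa using this
    have hq' : (q : K) ^ 2 = D * ℓ := by exact_mod_cast congrArg (Rat.cast : ℚ → K) hq
    field_simp
    linear_combination (q : K) ^ 2 * hψ' - D * hq'
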